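/- Let $f_s>0$, $M\ge 1$, $w=f_s/M$. A zero-mean wide-sense stationary (WSS) input $x(t)$ with power spectral density (PSD) $\mathcal S_X$ (non-negative, measurable, integrable) is sent through an LTI channel with bounded measurable frequency response $H$. The zero-mean stationary noise $\eta(t)$ has PSD $\mathcal S_\eta\ge 0$, which is integrable or constant (white noise), with $H=0$ wherever $\mathcal S_\eta=0$, and is uncorrelated with $x$. A bank of $M$ LTI filters has measurable frequency responses $S_1,\dots,S_M$ with $\int|S_k|^2(|H|^2\mathcal S_X+\mathcal S_\eta)\,df<\infty$ (an admissible bank). Its branch outputs $y_k=(h*s_k)*x+s_k*\eta$ are sampled as $y_k[n]=y_k(nM/f_s)$, $n\in\mathbb Z$, and $\hat x(t)$ is the optimal linear estimate of $x(t)$ from all the samples, i.e. its orthogonal projection on their closed linear span. Put $\gamma(f)=|H(f)|^2/\mathcal S_\eta(f)$, read as $0$ where $\mathcal S_\eta(f)=0$. Suppose that for almost every $f\in[-w/2,w/2)$ the $M$ largest values (with multiplicity) of $\gamma$ on the aliased set $\{f-iw: i\in\mathbb Z\}$ are attained, in decreasing order, at the frequencies $f-\ell_k(f)w$, $1\le k\le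 M$, with distinct integers $\ell_k(f)$ (ties being broken arbitrarily, but so that the following filters are measurable). The capacity-optimizing filter bank is $S^\star_k(f-lw)=1$ if $l=\ell_k(f)$ and $S^\star_k(f-lw)=0$ otherwise. A PSD $\mathcal S_X'$ is called an aliased rearrangement of $\mathcal S_X$ if for almost every $f\in[-w/2,w/2)$ its values on the aliased set of $f$ are a permutation of those of $\mathcal S_X$ (in particular $\mathcal S_X'=\mathcal S_X$ is allowed). 1. Let $\mathcal S_X$ be the capacity-optimal input PSD of power $P>0$ for the bank $S^\star$, i.e. the water-filling density $\mathcal S_X=[\nu-1/\gamma]^+$ on the pass bands of $S^\star$ (zero where $\gamma=0$), $\mathcal S_X=0$ elsewhere, with $\int\mathcal S_X\,df=P$. Then $\mathcal S_X$ is a PSD, $S^\star$ is admissible, and for every $t\in\mathbb R$ the linear MSE $\mathbb E|x(t)-\hat x(t)|^2$ with this input and the bank $S^\star$ is at most the linear MSE at $t$ with any admissible bank of $M$ LTI filters and the same input; it is even at most the one with any admissible bank of $M$ LTI filters and any WSS input whose PSD is an aliased rearrangement of $\mathcal S_X$. 2. More generally, let $x$ be any zero-mean WSS input whose PSD $\mathcal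 S_X$ has, on almost every aliased set, its $M$ largest values at the frequencies $f-\ell_1(f)w,\dots,f-\ell_M(f)w$, in decreasing order. Then $S^\star$ is admissible, and the linear MSE averaged over one sampling period, $\frac{f_s}{M}\int_0^{M/f_s}\mathbb E|x(t)-\hat x(t)|^2\,dt$, with this input and the bank $S^\star$ is at most the one with any admissible bank of $M$ LTI filters and any WSS input whose PSD is an aliased rearrangement of $\mathcal S_X$. -/

import Mathlib

open MeasureTheory Complex
open scoped ENNReal FourierTransform SchwartzMap ComplexConjugate

noncomputable section

namespace SampledChannel

variable {Ω : Type*} [MeasurableSpace Ω]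

/-! ### Second-order processes and their spectral calculus

Random variables with finite second moment are elements of `Lp ℂ 2 P`. -/

/-- The correlation `E[u v*]`. -/
def corr (P : Measure Ω) (u v : Lp ℂ 2 P) : ℂ :=
  ∫ ω, u ω * conj (v ω) ∂P

/-- The complex exponential `f ↦ exp(j2πft)`. -/
def expo (t f : ℝ) : ℂ := cexp (2 * Real.pi * I * f * t)

/-- A power spectral density of finite total power. -/
structure IsPSD (SX : ℝ → ℝ) : Prop where
  measurable : Measurable SX
  nonneg : ∀ f, 0 ≤ SX f
  integrable : Integrable SX

/-- The measure `S(f) df`. -/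
def spectralMeasure (S : ℝ → ℝ) : Measure ℝ :=
  volume.withDensity (fun f => ENNReal.ofReal (S f))

/-- `x` is a zero-mean wide-sense stationary process with power spectral density `SX`:
`E[x(t) x(s)*] = ∫ SX(f) exp(j2πf(t-s)) df`. -/
structure IsWSS (P : Measure Ω) (SX : ℝ → ℝ) (x : ℝ → Lp ℂ 2 P) : Prop where
  psd : IsPSD SX
  mean_zero : ∀ t, ∫ ω, x t ω ∂P = 0
  corr_eq : ∀ t s, corr P (x t) (x s) = ∫ f, (SX f : ℂ) * expo (t - s) f

/-- `η` is zero-mean stationary noise with power spectral density `Sη`, as a generalized process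
(so that white noise, `Sη` constant, is included): `η φ` stands for `∫ φ(t) η(t) dt`, which is
`∫ (𝓕⁻ φ)(f) dZ(f)` in terms of the spectral process `Z` of the noise. -/
structure IsStationaryNoise (P : Measure Ω) (Sη : ℝ → ℝ) (η : 𝓢(ℝ, ℂ) → Lp ℂ 2 P) : Prop where
  mean_zero : ∀ φ, ∫ ω, η φ ω ∂P = 0
  corr_eq : ∀ φ ψ, corr P (η φ) (η ψ) =
    ∫ f, (Sη f : ℂ) * ((𝓕⁻ φ : 𝓢(ℝ, ℂ)) f * conj ((𝓕⁻ ψ : 𝓢(ℝ, ℂ)) f))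

/-- `v = ∫ g(f) dZ(f)`, the spectral integral of `g ∈ L²(S(f) df)`, for a family of
random variables `ξ i` that are the spectral integrals of the functions `e i`: `v` is the
mean-square limit of linear combinations `∑ c i • ξ i` along which `∑ c i • e i` tends to
`g` in `L²(S(f) df)`. -/
def IsSpectralIntegral {P : Measure Ω} {ι : Type*} (S : ℝ → ℝ) (ξ : ι → Lp ℂ 2 P)
    (e : ι → ℝ → ℂ) (g : ℝ → ℂ) (v : Lp ℂ 2 P) : Prop :=
  ∀ ε : ℝ, 0 < ε → ∃ c : ι →₀ ℂ,
    ‖v - c.sum (fun i a => a • ξ i)‖ ≤ ε ∧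
    ∫⁻ f, ENNReal.ofReal (‖g f - c.sum (fun i a => a * e i f)‖ ^ 2) ∂(spectralMeasure S)
      ≤ ENNReal.ofReal ε

/-- `u` is the output of the LTI filter with frequency response `G` driven by the WSS process `x`
with power spectral density `SX`: `u(t) = ∫ G(f) exp(j2πft) dZ(f)`, where
`x(t) = ∫ exp(j2πft) dZ(f)`. -/
def IsFilteredProcess {P : Measure Ω} (SX : ℝ → ℝ) (x : ℝ → Lp ℂ 2 P) (G : ℝ → ℂ)
    (u : ℝ → Lp ℂ 2 P) : Prop :=
  ∀ t, IsSpectralIntegral SX x expo (fun f => G f * expo t f) (u t)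

/-- `v` is the output of the LTI filter with frequency response `G` driven by the noise `η`
with power spectral density `Sη`. -/
def IsFilteredNoise {P : Measure Ω} (Sη : ℝ → ℝ) (η : 𝓢(ℝ, ℂ) → Lp ℂ 2 P) (G : ℝ → ℂ)
    (v : ℝ → Lp ℂ 2 P) : Prop :=
  ∀ t, IsSpectralIntegral Sη η (fun φ f => (𝓕⁻ φ : 𝓢(ℝ, ℂ)) f) (fun f => G f * expo t f) (v t)

/-! ### Filter-bank sampling and linear estimation -/

/-- A bank of `M` LTI filters with frequency responses `S k` that can be driven by the output
of the channel `H` with input density `SX` and noise density `Sη`: every branch has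
finite signal and noise power. -/
structure IsFilterBank {M : ℕ} (H : ℝ → ℂ) (SX Sη : ℝ → ℝ) (S : Fin M → ℝ → ℂ) : Prop where
  measurable : ∀ k, Measurable (S k)
  signal_power : ∀ k, ∫⁻ f, ENNReal.ofReal (‖H f * S k f‖ ^ 2) ∂(spectralMeasure SX) < ∞
  noise_power : ∀ k, ∫⁻ f, ENNReal.ofReal (‖S k f‖ ^ 2) ∂(spectralMeasure Sη) < ∞

/-- The sampled channel before the samplers: the input `x` is WSS with density `SX`, the noise `η`
is stationary with density `Sη` and uncorrelated with the input, and the branch outputs are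
`y_k = (h * s_k) * x + s_k * η`. -/
structure IsFilterBankOutput {M : ℕ} (P : Measure Ω) (H : ℝ → ℂ) (SX Sη : ℝ → ℝ)
    (S : Fin M → ℝ → ℂ) (x : ℝ → Lp ℂ 2 P) (η : 𝓢(ℝ, ℂ) → Lp ℂ 2 P)
    (y : Fin M → ℝ → Lp ℂ 2 P) : Prop where
  input : IsWSS P SX x
  noise : IsStationaryNoise P Sη η
  uncorrelated : ∀ t φ, corr P (x t) (η φ) = 0
  bank : IsFilterBank H SX Sη S
  output : ∀ k, ∃ u v : ℝ → Lp ℂ 2 P,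
    IsFilteredProcess SX x (fun f => H f * S k f) u ∧ IsFilteredNoise Sη η (S k) v ∧
    ∀ t, y k t = u t + v t

/-- The closed linear span of the samples `y_k[n] = y_k(nT)`, `n ∈ ℤ`, `1 ≤ k ≤ M`. -/
def sampleSpan {M : ℕ} {P : Measure Ω} (T : ℝ) (y : Fin M → ℝ → Lp ℂ 2 P) :
    Submodule ℂ (Lp ℂ 2 P) :=
  (Submodule.span ℂ (Set.range fun q : Fin M × ℤ => y q.1 (q.2 * T))).topologicalClosure

/-- The optimal linear estimate of `X` from the samples, i.e. its orthogonal projection. -/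
def linearEstimate {M : ℕ} {P : Measure Ω} (T : ℝ) (y : Fin M → ℝ → Lp ℂ 2 P)
    (X : Lp ℂ 2 P) : Lp ℂ 2 P :=
  haveI : CompleteSpace (sampleSpan T y) :=
    (Submodule.isClosed_topologicalClosure _).completeSpace_coe
  (sampleSpan T y).starProjection X

/-- The linear mean squared error `E|x(t) - x̂(t)|²`, with sampling interval `T` in
each branch. -/
def linearMSE {M : ℕ} (P : Measure Ω) (T : ℝ) (x : ℝ → Lp ℂ 2 P)
    (y : Fin M → ℝ → Lp ℂ 2 P) (t : ℝ) : ℝ :=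
  ∫ ω, ‖x t ω - linearEstimate T y (x t) ω‖ ^ 2 ∂P

/-! ### Aliased sets, the capacity-optimizing filter bank and its input

`w` is the sampling rate of one branch, and the aliased set of `f` is `{f - i w | i ∈ ℤ}`. -/

/-- The signal-to-noise ratio `|H(f)|² / Sη(f)`. -/
def snr (H : ℝ → ℂ) (Sη : ℝ → ℝ) (f : ℝ) : ℝ := ‖H f‖ ^ 2 / Sη f

/-- One period of frequencies, up to an end point the interval `[-w/2, w/2]`. -/
def baseBand (w : ℝ) : Set ℝ := Set.Ico (-(w / 2)) (w / 2)

/-- `m 0, m 1, …` are distinct indices at which the `1st, 2nd, …, M`-th largest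
elements (with multiplicity) of the family `a (f - i w)`, `i ∈ ℤ`, are attained. -/
structure IsTopSelection {M : ℕ} (w : ℝ) (a : ℝ → ℝ) (f : ℝ) (m : Fin M → ℤ) : Prop where
  injective : Function.Injective m
  antitone : Antitone fun k => a (f - m k * w)
  dominates : ∀ l : ℤ, l ∉ Set.range m → ∀ k, a (f - l * w) ≤ a (f - m k * w)

/-- The filter bank that maximizes capacity: in each aliased set, the `k`-th filter passes
exactly the frequency `f - ℓ_k(f) w` at which the `k`-th largest SNR is attained. The choice `ℓ`
of the indices breaks ties. -/
structure IsOptimalBank {M : ℕ} (w : ℝ) (H : ℝ → ℂ) (Sη : ℝ → ℝ) (ℓ : Fin M → ℝ → ℤ)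
    (S : Fin M → ℝ → ℂ) : Prop where
  selection : ∀ᵐ f ∂(volume.restrict (baseBand w)),
    IsTopSelection w (snr H Sη) f (fun k => ℓ k f)
  response : ∀ k, ∀ f ∈ baseBand w, ∀ l : ℤ,
    S k (f - l * w) = if l = ℓ k f then 1 else 0
  measurable : ∀ k, Measurable (S k)

open Classical in
/-- Water filling with level `ν` on the pass bands of the filter bank `S`: the density is
`[ν - Sη/|H|²]⁺` at the frequencies that some filter passes (`0` where `H` vanishes) and `0`
at all others. -/
def waterFilling {M : ℕ} (H : ℝ → ℂ) (Sη : ℝ → ℝ) (S : Fin M → ℝ → ℂ) (ν : ℝ) (f : ℝ) : ℝ :=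
  if (∃ k, S k f ≠ 0) ∧ snr H Sη f ≠ 0 then max (ν - 1 / snr H Sη f) 0 else 0

/-- On almost every aliased set, the values of `SX'` are a permutation of those of `SX`. -/
def IsAliasRearrangement (w : ℝ) (SX SX' : ℝ → ℝ) : Prop :=
  ∀ᵐ f ∂(volume.restrict (baseBand w)), ∃ σ : Equiv.Perm ℤ,
    ∀ l : ℤ, SX' (f - l * w) = SX (f - σ l * w)

/-- On almost every aliased set, the `M` largest values of `SX` lie, in decreasing order, at the
frequencies selected by `ℓ`. -/
def IsMatched {M : ℕ} (w : ℝ) (ℓ : Fin M → ℝ → ℤ) (SX : ℝ → ℝ) : Prop :=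
  ∀ᵐ f ∂(volume.restrict (baseBand w)), IsTopSelection w SX f (fun k => ℓ k f)

end SampledChannel

end

/-! By the spectral isometry, estimating `x t` by a finite combination of samples with frequency
response `G` costs `∫ |e_t - H G|² SX + |G|² Sη`, where `e_t` is `expo t`
(`IsFilterBankOutput.ofReal_norm_sub_sq`). Completing the square (`norm_sub_sq_add_eq`) turns the
integrand into `SX - gain SX γ` plus a weighted squared distance from `G` to the Wiener response.
The question is therefore how much of the total gain a bank can recover.

The sampling phases are constant on an aliased set, so there `G` lies in the span of the `M` vectors
`(S_k (f - l w))_l`. The optimal bank passes `M` single frequencies. Periodic functions are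
approximated by trigonometric polynomials, so it recovers the full gain at these frequencies for
every `t` (`linearMSE_add_recoveredPower_le`).

For the converse, `gain s γ` is the integral over `0 < u ≤ s` of a function increasing in `γ`. A
layer-cake rearrangement argument (`sum_mul_gain_le`) then shows that pairing the largest `s` with
the largest `γ` maximizes any sum of gains with weights in `[0, 1]` of total at most `M`.

A water-filling density has at most `M` nonzero values per aliased set, so the unrestricted Wiener
bound already gives such a sum, at each `t`. For a general density no bound at a fixed instant is
available: a single filter equal to the Wiener response at `t = 0` recovers the whole gain at that
instant. Averaged over a period, however, the phases of aliased frequencies are orthogonal, and an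
`M`-dimensional space captures only a fraction `ω l` of the `l`-th gain, with `∑ ω l ≤ M`
(`exists_weights_of_finrank_le`). Finite windows of `2L + 1` frequencies, sampled at `2L + 1`
instants, make this exact; then `L` grows. -/

namespace SampledChannel

/-! ### Spectral isometry -/

section Spectral

variable {Ω : Type*} [MeasurableSpace Ω] {P : Measure Ω} {ι : Type*}

lemma corr_eq_inner (u v : Lp ℂ 2 P) : corr P u v = inner ℂ v u := by
  rw [L2.inner_def]
  rfl

lemma ofReal_norm_toLp_sq {α : Type*} [MeasurableSpace α] {μ : Measure α} {g : α → ℂ}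
    (h : MemLp g 2 μ) :
    ENNReal.ofReal (‖h.toLp g‖ ^ 2) = ∫⁻ f, ENNReal.ofReal (‖g f‖ ^ 2) ∂μ := by
  rw [Lp.norm_toLp, ENNReal.ofReal_pow ENNReal.toReal_nonneg, ENNReal.ofReal_toReal h.2.ne,
    eLpNorm_eq_lintegral_rpow_enorm_toReal (by norm_num) (by norm_num), ← ENNReal.rpow_natCast,
    ← ENNReal.rpow_mul]
  norm_num

lemma memLp_two_of_lintegral {α : Type*} [MeasurableSpace α] {μ : Measure α} {g : α → ℂ}
    (hg : AEStronglyMeasurable g μ) (h : ∫⁻ f, ENNReal.ofReal (‖g f‖ ^ 2) ∂μ < ∞) :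
    MemLp g 2 μ := by
  refine ⟨hg, ?_⟩
  rw [eLpNorm_lt_top_iff_lintegral_rpow_enorm_lt_top (by norm_num) (by norm_num)]
  convert h using 3 with f
  rw [ENNReal.ofReal_pow (norm_nonneg _), ofReal_norm]
  norm_num

/-- The closure of the linear relation that pairs `ξ i` with the function `e i`. -/
noncomputable def spectralGraph (P : Measure Ω) (S : ℝ → ℝ) (ξ : ι → Lp ℂ 2 P) (e : ι → ℝ → ℂ) :
    Submodule ℂ (Lp ℂ 2 P × Lp ℂ 2 (spectralMeasure S)) :=
  (Submodule.span ℂ {p | ∃ i, p.1 = ξ i ∧ p.2 =ᵐ[spectralMeasure S] e i}).topologicalClosure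

/-- `v` corresponds to the function `g` under the spectral isometry. -/
def SpectralPair (S : ℝ → ℝ) (ξ : ι → Lp ℂ 2 P) (e : ι → ℝ → ℂ) (g : ℝ → ℂ) (v : Lp ℂ 2 P) :
    Prop :=
  ∃ hg : MemLp g 2 (spectralMeasure S), (v, hg.toLp g) ∈ spectralGraph P S ξ e

variable {S : ℝ → ℝ} {ξ : ι → Lp ℂ 2 P} {e : ι → ℝ → ℂ} {g g' : ℝ → ℂ} {v v' : Lp ℂ 2 P}

/-- Inner products agree on the generators, hence on their span by sesquilinearity, and equality of
norms passes to the closure. -/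
lemma spectralGraph_norm_eq
    (h : ∀ i j, corr P (ξ i) (ξ j) = ∫ f, e i f * conj (e j f) ∂(spectralMeasure S))
    {p : Lp ℂ 2 P × Lp ℂ 2 (spectralMeasure S)} (hp : p ∈ spectralGraph P S ξ e) :
    ‖p.1‖ = ‖p.2‖ := by
  have hcl : IsClosed {p : Lp ℂ 2 P × Lp ℂ 2 (spectralMeasure S) | ‖p.1‖ = ‖p.2‖} :=
    isClosed_eq (by fun_prop) (by fun_prop)
  refine closure_minimal ?_ hcl hp
  intro p hp
  have key : ∀ p ∈ Submodule.span ℂ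
      {p : Lp ℂ 2 P × Lp ℂ 2 (spectralMeasure S) | ∃ i, p.1 = ξ i ∧ p.2 =ᵐ[spectralMeasure S] e i},
      ∀ q ∈ Submodule.span ℂ
      {p : Lp ℂ 2 P × Lp ℂ 2 (spectralMeasure S) | ∃ i, p.1 = ξ i ∧ p.2 =ᵐ[spectralMeasure S] e i},
      inner ℂ p.1 q.1 = inner ℂ p.2 q.2 := by
    intro p hp q hq
    induction hp, hq using Submodule.span_induction₂ with
    | mem_mem p q hp hq =>
      obtain ⟨i, hi, hi'⟩ := hp
      obtain ⟨j, hj, hj'⟩ := hq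
      rw [hi, hj, ← corr_eq_inner, h, L2.inner_def]
      refine integral_congr_ae ?_
      filter_upwards [hi', hj'] with f h1 h2
      rw [h1, h2]
      rfl
    | zero_left y hy => simp
    | zero_right y hy => simp
    | add_left x y z _ _ _ h1 h2 => simp [inner_add_left, h1, h2]
    | add_right x y z _ _ _ h1 h2 => simp [inner_add_right, h1, h2]
    | smul_left r x y _ _ h1 => simp [inner_smul_left, h1]
    | smul_right r x y _ _ h1 => simp [inner_smul_right, h1]
  have := key p hp p hp
  rw [inner_self_eq_norm_sq_to_K, inner_self_eq_norm_sq_to_K] at this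
  have h2 : ‖p.1‖ ^ 2 = ‖p.2‖ ^ 2 := by exact_mod_cast this
  exact (sq_eq_sq₀ (norm_nonneg _) (norm_nonneg _)).1 h2

lemma SpectralPair.ofReal_norm_sq
    (h : ∀ i j, corr P (ξ i) (ξ j) = ∫ f, e i f * conj (e j f) ∂(spectralMeasure S))
    (hv : SpectralPair S ξ e g v) :
    ENNReal.ofReal (‖v‖ ^ 2) = ∫⁻ f, ENNReal.ofReal (‖g f‖ ^ 2) ∂(spectralMeasure S) := by
  obtain ⟨hg, hv⟩ := hv
  rw [← ofReal_norm_toLp_sq hg, ← spectralGraph_norm_eq h hv]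

lemma SpectralPair.add (hv : SpectralPair S ξ e g v) (hv' : SpectralPair S ξ e g' v') :
    SpectralPair S ξ e (fun f => g f + g' f) (v + v') := by
  obtain ⟨hg, hv⟩ := hv
  obtain ⟨hg', hv'⟩ := hv'
  exact ⟨hg.add hg', (spectralGraph P S ξ e).add_mem hv hv'⟩

lemma SpectralPair.sub (hv : SpectralPair S ξ e g v) (hv' : SpectralPair S ξ e g' v') :
    SpectralPair S ξ e (fun f => g f - g' f) (v - v') := by
  obtain ⟨hg, hv⟩ := hv
  obtain ⟨hg', hv'⟩ := hv'
  exact ⟨hg.sub hg', (spectralGraph P S ξ e).sub_mem hv hv'⟩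

lemma SpectralPair.smul (hv : SpectralPair S ξ e g v) (c : ℂ) :
    SpectralPair S ξ e (fun f => c * g f) (c • v) := by
  obtain ⟨hg, hv⟩ := hv
  exact ⟨hg.const_smul c, (spectralGraph P S ξ e).smul_mem c hv⟩

lemma SpectralPair.zero : SpectralPair S ξ e (fun _ => 0) 0 :=
  ⟨MemLp.zero', (spectralGraph P S ξ e).zero_mem⟩

lemma SpectralPair.single {i : ι} (hi : MemLp (e i) 2 (spectralMeasure S)) :
    SpectralPair S ξ e (e i) (ξ i) :=
  ⟨hi, subset_closure (Submodule.subset_span ⟨i, rfl, hi.coeFn_toLp⟩)⟩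

lemma SpectralPair.finset_sum {κ : Type*} (s : Finset κ) (c : κ → ℂ) {g : κ → ℝ → ℂ}
    {v : κ → Lp ℂ 2 P} (h : ∀ q, SpectralPair S ξ e (g q) (v q)) :
    SpectralPair S ξ e (fun f => ∑ q ∈ s, c q * g q f) (∑ q ∈ s, c q • v q) := by
  classical
  induction s using Finset.induction_on with
  | empty => simpa using SpectralPair.zero
  | insert a s ha ih =>
    simp only [Finset.sum_insert ha]
    exact ((h a).smul (c a)).add ih

lemma SpectralPair.finset_sum_single (he : ∀ i, MemLp (e i) 2 (spectralMeasure S))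
    (c : ι →₀ ℂ) :
    ∃ hg : MemLp (fun f => c.sum fun i a => a * e i f) 2 (spectralMeasure S),
      ((c.sum fun i a => a • ξ i, hg.toLp _) :
        Lp ℂ 2 P × Lp ℂ 2 (spectralMeasure S)) ∈ spectralGraph P S ξ e :=
  SpectralPair.finset_sum c.support c fun i => SpectralPair.single (he i)

lemma IsSpectralIntegral.spectralPair (he : ∀ i, MemLp (e i) 2 (spectralMeasure S))
    (hg : MemLp g 2 (spectralMeasure S)) (hv : IsSpectralIntegral S ξ e g v) :
    SpectralPair S ξ e g v := by
  refine ⟨hg, ?_⟩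
  have hcl : IsClosed (spectralGraph P S ξ e : Set (Lp ℂ 2 P × Lp ℂ 2 (spectralMeasure S))) :=
    Submodule.isClosed_topologicalClosure _
  rw [← SetLike.mem_coe, ← hcl.closure_eq, Metric.mem_closure_iff]
  intro ε hε
  -- The same tolerance bounds a norm in the first component and a squared norm in the second, hence
  -- the minimum.
  obtain ⟨c, h1, h2⟩ := hv (min (ε / 2) ((ε / 2) ^ 2)) (by positivity)
  obtain ⟨hc, hmem⟩ := SpectralPair.finset_sum_single (ξ := ξ) he c
  refine ⟨_, hmem, ?_⟩
  rw [Prod.dist_eq, max_lt_iff, dist_eq_norm, dist_eq_norm]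
  refine ⟨lt_of_le_of_lt (h1.trans (min_le_left _ _)) (by linarith), ?_⟩
  simp only
  rw [← MemLp.toLp_sub hg hc]
  have h3 : ENNReal.ofReal (‖(hg.sub hc).toLp _‖ ^ 2) ≤ ENNReal.ofReal ((ε / 2) ^ 2) := by
    rw [ofReal_norm_toLp_sq]
    exact h2.trans (ENNReal.ofReal_le_ofReal (min_le_right _ _))
  rw [ENNReal.ofReal_le_ofReal_iff (by positivity)] at h3
  have := abs_le_of_sq_le_sq h3 (by positivity)
  rw [abs_norm] at this
  linarith

/-- This carries the orthogonality of `x` and `η` over to their spectral integrals. -/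
lemma SpectralPair.mem_closure_span (hv : SpectralPair S ξ e g v) :
    v ∈ (Submodule.span ℂ (Set.range ξ)).topologicalClosure := by
  obtain ⟨hg, hv⟩ := hv
  have hsub : spectralGraph P S ξ e ≤
      (Submodule.span ℂ (Set.range ξ)).topologicalClosure.comap
        (LinearMap.fst ℂ (Lp ℂ 2 P) (Lp ℂ 2 (spectralMeasure S))) := by
    refine Submodule.topologicalClosure_minimal _ ?_ ?_
    · rw [Submodule.span_le]
      rintro p ⟨i, hi, -⟩
      refine subset_closure (Submodule.subset_span ⟨i, hi.symm⟩)
    · exact (Submodule.isClosed_topologicalClosure _).preimage continuous_fst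
  exact hsub hv

lemma inner_eq_zero_of_mem_closure_span {E ι κ : Type*} [NormedAddCommGroup E]
    [InnerProductSpace ℂ E] {a : ι → E} {b : κ → E} (h : ∀ i j, inner ℂ (a i) (b j) = 0) {u v : E}
    (hu : u ∈ (Submodule.span ℂ (Set.range a)).topologicalClosure)
    (hv : v ∈ (Submodule.span ℂ (Set.range b)).topologicalClosure) : inner ℂ u v = 0 := by
  have h1 : Submodule.span ℂ (Set.range a) ⟂ Submodule.span ℂ (Set.range b) := by
    rw [Submodule.isOrtho_span]
    rintro _ ⟨i, rfl⟩ _ ⟨j, rfl⟩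
    exact h i j
  have h2 : (Submodule.span ℂ (Set.range a)).topologicalClosure ⟂
      (Submodule.span ℂ (Set.range b)).topologicalClosure := by
    refine Submodule.topologicalClosure_minimal _ ?_ (Submodule.isClosed_orthogonal _)
    rw [← Submodule.IsOrtho, Submodule.isOrtho_comm]
    refine Submodule.topologicalClosure_minimal _ ?_ (Submodule.isClosed_orthogonal _)
    exact h1.symm
  exact h2.inner_eq hu hv

end Spectral

/-! ### Spectral measures -/

lemma measurable_expo (t : ℝ) : Measurable (expo t) := by
  unfold expo; fun_prop

lemma norm_expo (t f : ℝ) : ‖expo t f‖ = 1 := by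
  have : (2 * Real.pi * I * f * t : ℂ) = ((2 * Real.pi * f * t : ℝ) : ℂ) * I := by
    push_cast; ring
  rw [expo, this, norm_exp_ofReal_mul_I]

lemma conj_expo (t f : ℝ) : conj (expo t f) = expo (-t) f := by
  rw [expo, expo, ← exp_conj]
  simp [Complex.conj_ofNat]

lemma expo_add_mul (t s f : ℝ) : expo (t + s) f = expo t f * expo s f := by
  rw [expo, expo, expo, ← Complex.exp_add]
  push_cast; ring_nf

lemma lintegral_spectralMeasure {S : ℝ → ℝ} (hS : Measurable S) {F : ℝ → ℝ}
    (hF : Measurable F) (hF0 : ∀ f, 0 ≤ F f) :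
    ∫⁻ f, ENNReal.ofReal (F f) ∂(spectralMeasure S) = ∫⁻ f, ENNReal.ofReal (F f * S f) := by
  rw [spectralMeasure, lintegral_withDensity_eq_lintegral_mul _ (by fun_prop) (by fun_prop)]
  refine lintegral_congr fun f => ?_
  rw [Pi.mul_apply, ENNReal.ofReal_mul (hF0 f), mul_comm]

lemma integral_spectralMeasure {S : ℝ → ℝ} (hS : Measurable S) (hS0 : ∀ f, 0 ≤ S f) (F : ℝ → ℂ) :
    ∫ f, F f ∂(spectralMeasure S) = ∫ f, (S f : ℂ) * F f := by
  rw [spectralMeasure, integral_withDensity_eq_integral_toReal_smul (by fun_prop) (by simp)]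
  refine integral_congr_ae (.of_forall fun f => ?_)
  simp [ENNReal.toReal_ofReal (hS0 f)]

lemma isFiniteMeasure_spectralMeasure {S : ℝ → ℝ} (hS : Integrable S) :
    IsFiniteMeasure (spectralMeasure S) := by
  refine isFiniteMeasure_withDensity ?_
  exact (hS.lintegral_lt_top).ne

lemma memLp_expo {S : ℝ → ℝ} (hS : Integrable S) (t : ℝ) :
    MemLp (expo t) 2 (spectralMeasure S) := by
  have := isFiniteMeasure_spectralMeasure hS
  exact MemLp.of_bound (measurable_expo t).aestronglyMeasurable 1
    (.of_forall fun f => (norm_expo t f).le)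

lemma memLp_schwartz {S : ℝ → ℝ} (hS : Integrable S ∨ ∃ N₀ : ℝ, ∀ f, S f = N₀) (φ : 𝓢(ℝ, ℂ)) :
    MemLp φ 2 (spectralMeasure S) := by
  rcases hS with hS | ⟨N₀, hN⟩
  · have := isFiniteMeasure_spectralMeasure hS
    exact MemLp.of_bound φ.continuous.measurable.aestronglyMeasurable _
      (.of_forall fun f => SchwartzMap.norm_le_seminorm ℝ φ f)
  · have : spectralMeasure S = ENNReal.ofReal N₀ • volume := by
      simp [spectralMeasure, hN, withDensity_const]
    rw [this]
    exact (φ.memLp 2).smul_measure ENNReal.ofReal_ne_top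

/-! ### The mean squared error of a linear combination of samples -/

/-- The frequency response of the linear combination `c` of samples. -/
noncomputable def combination {M : ℕ} (T : ℝ) (S : Fin M → ℝ → ℂ) (c : Fin M × ℤ →₀ ℂ) (f : ℝ) :
    ℂ :=
  ∑ q ∈ c.support, c q * (S q.1 f * expo (q.2 * T) f)

lemma measurable_combination {M : ℕ} (T : ℝ) {S : Fin M → ℝ → ℂ} (hS : ∀ k, Measurable (S k))
    (c : Fin M × ℤ →₀ ℂ) : Measurable (combination T S c) := by
  unfold combination
  refine Finset.measurable_sum _ fun q _ => ?_
  exact ((hS q.1).mul (measurable_expo _)).const_mul _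

section Output

variable {Ω : Type*} [MeasurableSpace Ω] {P : Measure Ω} {M : ℕ} {H : ℝ → ℂ} {SX Sη : ℝ → ℝ}
  {S : Fin M → ℝ → ℂ} {x : ℝ → Lp ℂ 2 P} {η : 𝓢(ℝ, ℂ) → Lp ℂ 2 P} {y : Fin M → ℝ → Lp ℂ 2 P}

lemma IsWSS.corr_spectral (hx : IsWSS P SX x) (t s : ℝ) :
    corr P (x t) (x s) = ∫ f, expo t f * conj (expo s f) ∂(spectralMeasure SX) := by
  rw [hx.corr_eq, integral_spectralMeasure hx.psd.measurable hx.psd.nonneg]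
  simp_rw [conj_expo, ← expo_add_mul, sub_eq_add_neg]

lemma IsStationaryNoise.corr_spectral (hη : IsStationaryNoise P Sη η) (hS : Measurable Sη)
    (hS0 : ∀ f, 0 ≤ Sη f) (φ ψ : 𝓢(ℝ, ℂ)) :
    corr P (η φ) (η ψ) =
      ∫ f, (𝓕⁻ φ : 𝓢(ℝ, ℂ)) f * conj ((𝓕⁻ ψ : 𝓢(ℝ, ℂ)) f) ∂(spectralMeasure Sη) := by
  rw [hη.corr_eq, integral_spectralMeasure hS hS0]

lemma lintegral_norm_mul_expo_sq {μ : Measure ℝ} (G : ℝ → ℂ) (t : ℝ) :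
    ∫⁻ f, ENNReal.ofReal (‖G f * expo t f‖ ^ 2) ∂μ = ∫⁻ f, ENNReal.ofReal (‖G f‖ ^ 2) ∂μ := by
  simp [norm_expo]

/-- The error is a spectral integral of the input minus one of the noise. These are orthogonal, so
the squared norms add, and each is read off from its isometry. -/
theorem IsFilterBankOutput.ofReal_norm_sub_sq (h : IsFilterBankOutput P H SX Sη S x η y)
    (hH : Measurable H) (hSη : Measurable Sη) (hSη_nonneg : ∀ f, 0 ≤ Sη f)
    (hnoise : Integrable Sη ∨ ∃ N₀ : ℝ, ∀ f, Sη f = N₀) (T t : ℝ) (c : Fin M × ℤ →₀ ℂ) :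
    ENNReal.ofReal (‖x t - ∑ q ∈ c.support, c q • y q.1 (q.2 * T)‖ ^ 2) =
      ∫⁻ f, ENNReal.ofReal (‖expo t f - H f * combination T S c f‖ ^ 2 * SX f +
        ‖combination T S c f‖ ^ 2 * Sη f) := by
  choose u v hu hv huv using h.output
  have hX := h.input.psd
  have heX : ∀ t, MemLp (expo t) 2 (spectralMeasure SX) := memLp_expo hX.integrable
  have heη : ∀ φ : 𝓢(ℝ, ℂ), MemLp (fun f => (𝓕⁻ φ : 𝓢(ℝ, ℂ)) f) 2 (spectralMeasure Sη) :=
    fun φ => memLp_schwartz hnoise _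
  have hu' : ∀ q : Fin M × ℤ, SpectralPair SX x expo
      (fun f => H f * S q.1 f * expo (q.2 * T) f) (u q.1 (q.2 * T)) := fun q =>
    IsSpectralIntegral.spectralPair heX (memLp_two_of_lintegral
      ((hH.mul (h.bank.measurable _)).mul (measurable_expo _)).aestronglyMeasurable
      (by rw [lintegral_norm_mul_expo_sq]; exact h.bank.signal_power q.1)) (hu q.1 _)
  have hv' : ∀ q : Fin M × ℤ, SpectralPair Sη η (fun φ f => (𝓕⁻ φ : 𝓢(ℝ, ℂ)) f)
      (fun f => S q.1 f * expo (q.2 * T) f) (v q.1 (q.2 * T)) := fun q =>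
    IsSpectralIntegral.spectralPair heη (memLp_two_of_lintegral
      ((h.bank.measurable _).mul (measurable_expo _)).aestronglyMeasurable
      (by rw [lintegral_norm_mul_expo_sq]; exact h.bank.noise_power q.1)) (hv q.1 _)
  have h1 := (SpectralPair.single (ξ := x) (heX t)).sub
    (SpectralPair.finset_sum c.support c hu')
  have h2 := SpectralPair.finset_sum c.support c hv'
  have horth := inner_eq_zero_of_mem_closure_span (a := x) (b := η) (fun t φ => by
    rw [← inner_conj_symm, ← corr_eq_inner, h.uncorrelated, map_zero])
    h1.mem_closure_span h2.mem_closure_span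
  have hsum : x t - ∑ q ∈ c.support, c q • y q.1 (q.2 * T) =
      (x t - ∑ q ∈ c.support, c q • u q.1 (q.2 * T)) -
        ∑ q ∈ c.support, c q • v q.1 (q.2 * T) := by
    simp_rw [huv, smul_add, Finset.sum_add_distrib]
    abel
  have hm := measurable_combination T h.bank.measurable c
  rw [hsum, @norm_sub_sq ℂ, horth, map_zero, mul_zero, sub_zero, ENNReal.ofReal_add (by positivity)
    (by positivity), h1.ofReal_norm_sq h.input.corr_spectral,
    h2.ofReal_norm_sq (h.noise.corr_spectral hSη hSη_nonneg)]
  have e1 : ∀ f, ∑ q ∈ c.support, c q * (H f * S q.1 f * expo (q.2 * T) f) =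
      H f * combination T S c f := fun f => by
    rw [combination, Finset.mul_sum]
    exact Finset.sum_congr rfl fun q _ => by ring
  have e2 : ∀ f, ∑ q ∈ c.support, c q * (S q.1 f * expo (q.2 * T) f) =
      combination T S c f := fun f => rfl
  simp_rw [e1, e2]
  have hm1 : Measurable fun f => ‖expo t f - H f * combination T S c f‖ ^ 2 :=
    (((measurable_expo t).sub (hH.mul hm)).norm).pow_const 2
  rw [lintegral_spectralMeasure hX.measurable hm1 (fun f => by positivity),
    lintegral_spectralMeasure hSη (hm.norm.pow_const 2) (fun f => by positivity),
    ← lintegral_add_left (by have := hX.measurable; fun_prop)]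
  refine lintegral_congr fun f => ?_
  rw [ENNReal.ofReal_add (mul_nonneg (by positivity) (hX.nonneg f))
    (mul_nonneg (by positivity) (hSη_nonneg f))]

/-- With `R` the autocorrelation, `‖x t - x s‖² = 2 R(0) - 2 Re R(s - t)`, and `R` is continuous by
dominated convergence. Mean-square continuity is needed to integrate the error over a period. -/
lemma continuous_of_isWSS (hx : IsWSS P SX x) : Continuous x := by
  have hc : Continuous fun t => ∫ f, (SX f : ℂ) * expo t f := by
    refine continuous_of_dominated (bound := fun f => SX f) (fun t => ?_) (fun t => ?_)
      hx.psd.integrable (.of_forall fun f => ?_)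
    · exact (hx.psd.measurable.complex_ofReal.mul (measurable_expo t)).aestronglyMeasurable
    · refine .of_forall fun f => ?_
      simp [norm_expo, abs_of_nonneg (hx.psd.nonneg f)]
    · unfold expo; fun_prop
  have hn : ∀ t s, ‖x t - x s‖ ^ 2 =
      2 * (∫ f, (SX f : ℂ) * expo 0 f).re - 2 * (∫ f, (SX f : ℂ) * expo (s - t) f).re := by
    intro t s
    have e1 : ∀ t, ‖x t‖ ^ 2 = (∫ f, (SX f : ℂ) * expo 0 f).re := fun t => by
      rw [← inner_self_eq_norm_sq (𝕜 := ℂ), ← corr_eq_inner, hx.corr_eq, sub_self]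
      rfl
    rw [@norm_sub_sq ℂ, e1, e1, ← corr_eq_inner, hx.corr_eq]
    simp only [RCLike.re_eq_complex_re]
    ring
  rw [continuous_iff_continuousAt]
  intro s
  rw [ContinuousAt, tendsto_iff_norm_sub_tendsto_zero]
  have h2 : Filter.Tendsto (fun t => ‖x t - x s‖ ^ 2) (nhds s) (nhds 0) := by
    simp_rw [hn]
    have : Continuous fun t => 2 * (∫ f, (SX f : ℂ) * expo 0 f).re -
        2 * (∫ f, (SX f : ℂ) * expo (s - t) f).re :=
      continuous_const.sub (continuous_const.mul
        (continuous_re.comp (hc.comp (continuous_const.sub continuous_id))))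
    convert this.tendsto s using 2
    simp
  have h3 := (Real.continuous_sqrt.tendsto 0).comp h2
  simpa [Function.comp_def] using h3

lemma integral_norm_sub_sq (u v : Lp ℂ 2 P) : ∫ ω, ‖u ω - v ω‖ ^ 2 ∂P = ‖u - v‖ ^ 2 := by
  rw [← inner_self_eq_norm_sq (𝕜 := ℂ), L2.inner_def]
  have : ∫ ω, inner ℂ ((u - v : Lp ℂ 2 P) ω) ((u - v : Lp ℂ 2 P) ω) ∂P =
      ∫ ω, ((‖u ω - v ω‖ ^ 2 : ℝ) : ℂ) ∂P := by
    refine integral_congr_ae ?_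
    filter_upwards [Lp.coeFn_sub u v] with ω hω
    rw [hω, inner_self_eq_norm_sq_to_K]
    simp
  rw [this]
  exact (congrArg Complex.re (integral_ofReal (𝕜 := ℂ)
    (f := fun ω => ‖u ω - v ω‖ ^ 2))).symm

lemma linearMSE_eq (T t : ℝ) :
    linearMSE P T x y t = ‖x t - linearEstimate T y (x t)‖ ^ 2 :=
  integral_norm_sub_sq _ _

lemma linearMSE_nonneg (T t : ℝ) : 0 ≤ linearMSE P T x y t := by
  rw [linearMSE_eq]; positivity

lemma linearMSE_le (T t : ℝ) (c : Fin M × ℤ →₀ ℂ) :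
    linearMSE P T x y t ≤ ‖x t - ∑ q ∈ c.support, c q • y q.1 (q.2 * T)‖ ^ 2 := by
  have : CompleteSpace (sampleSpan T y) :=
    (Submodule.isClosed_topologicalClosure _).completeSpace_coe
  rw [linearMSE_eq, linearEstimate, Submodule.starProjection_minimal]
  have hmem : ∑ q ∈ c.support, c q • y q.1 (q.2 * T) ∈ sampleSpan T y :=
    subset_closure (Submodule.sum_mem _ fun q _ =>
      Submodule.smul_mem _ _ (Submodule.subset_span ⟨q, rfl⟩))
  gcongr
  · exact Real.iInf_nonneg fun _ => norm_nonneg _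
  · exact ciInf_le ⟨0, by rintro _ ⟨_, rfl⟩; positivity⟩ (⟨_, hmem⟩ : sampleSpan T y)

lemma exists_norm_sub_sq_le_linearMSE (T t : ℝ) {ε : ℝ} (hε : 0 < ε) :
    ∃ c : Fin M × ℤ →₀ ℂ,
      ‖x t - ∑ q ∈ c.support, c q • y q.1 (q.2 * T)‖ ^ 2 ≤ linearMSE P T x y t + ε := by
  have : CompleteSpace (sampleSpan T y) :=
    (Submodule.isClosed_topologicalClosure _).completeSpace_coe
  have hmem : linearEstimate T y (x t) ∈ sampleSpan T y := Submodule.starProjection_apply_mem _ _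
  have hopen : IsOpen {v : Lp ℂ 2 P | ‖x t - v‖ ^ 2 < linearMSE P T x y t + ε} :=
    isOpen_lt (by fun_prop) continuous_const
  obtain ⟨v, hv, hv'⟩ := mem_closure_iff.1 hmem _ hopen
    (by rw [Set.mem_ofPred_eq, linearMSE_eq]; linarith)
  obtain ⟨c, rfl⟩ := Finsupp.mem_span_range_iff_exists_finsupp.1 hv'
  exact ⟨c, le_of_lt hv⟩

lemma continuous_linearMSE (hx : IsWSS P SX x) (T : ℝ) : Continuous (linearMSE P T x y) := by
  have hc := continuous_of_isWSS hx
  have : linearMSE P T x y = fun t => ‖x t - linearEstimate T y (x t)‖ ^ 2 :=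
    funext fun t => linearMSE_eq T t
  rw [this]
  unfold linearEstimate
  fun_prop

end Output

/-! ### Aliased sets -/

section Fibers

lemma measurableSet_baseBand (w : ℝ) : MeasurableSet (baseBand w) := measurableSet_Ico

lemma exists_mem_baseBand {w : ℝ} (hw : 0 < w) (f : ℝ) :
    ∃ f₀ ∈ baseBand w, ∃ l : ℤ, f = f₀ - l * w := by
  have h : f ∈ ⋃ n : ℤ, Set.Ico (-(w / 2) + n • w) (-(w / 2) + (n + 1) • w) := by
    rw [iUnion_Ico_add_zsmul hw]; trivial
  obtain ⟨n, h1, h2⟩ := Set.mem_iUnion.1 h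
  simp only [zsmul_eq_mul, Int.cast_add, Int.cast_one] at h1 h2
  refine ⟨f - n * w, ⟨by linarith, by linarith⟩, -n, ?_⟩
  push_cast; ring

/-- Folding the line onto one period; every global integral is compared aliased set by aliased set
through this identity. -/
lemma lintegral_eq_lintegral_tsum {w : ℝ} (hw : 0 < w) {F : ℝ → ℝ≥0∞} (hF : Measurable F) :
    ∫⁻ f, F f = ∫⁻ f in baseBand w, ∑' l : ℤ, F (f - l * w) := by
  have h1 : ∫⁻ f, F f =
      ∑' n : ℤ, ∫⁻ f in Set.Ico (-(w / 2) + n • w) (-(w / 2) + (n + 1) • w), F f := by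
    rw [← lintegral_iUnion (fun _ => measurableSet_Ico) (Set.pairwise_disjoint_Ico_add_zsmul _ _),
      iUnion_Ico_add_zsmul hw, setLIntegral_univ]
  have h2 : ∀ n : ℤ, ∫⁻ f in Set.Ico (-(w / 2) + n • w) (-(w / 2) + (n + 1) • w), F f =
      ∫⁻ f in baseBand w, F (f + n * w) := fun n => by
    have : baseBand w = (fun f => f + n * w) ⁻¹'
        Set.Ico (-(w / 2) + n • w) (-(w / 2) + (n + 1) • w) := by
      ext f
      simp only [baseBand, Set.mem_Ico, Set.mem_preimage, zsmul_eq_mul, Int.cast_add, Int.cast_one]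
      constructor <;> rintro ⟨h1, h2⟩ <;> constructor <;> linarith
    rw [this, (measurePreserving_add_right volume (n * w)).setLIntegral_comp_preimage
      measurableSet_Ico hF]
  rw [h1, lintegral_tsum fun l => by fun_prop]
  simp_rw [h2]
  -- The translates arise as `f + n w`, whereas aliased sets are written `f - l w`.
  rw [← (Equiv.neg ℤ).tsum_eq]
  simp [sub_eq_add_neg]

lemma ae_of_ae_baseBand {w : ℝ} (hw : 0 < w) {Q : ℝ → Prop}
    (h : ∀ᵐ f ∂(volume.restrict (baseBand w)), ∀ l : ℤ, Q (f - l * w)) : ∀ᵐ f, Q f := by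
  rw [ae_restrict_iff' (measurableSet_baseBand w)] at h
  have h2 : ∀ᵐ f, ∀ l : ℤ, f + l * w ∈ baseBand w → Q f := by
    rw [ae_all_iff]
    intro l
    filter_upwards [(measurePreserving_add_right volume
      ((l : ℝ) * w)).quasiMeasurePreserving.ae h] with f hf hmem
    simpa using hf hmem l
  filter_upwards [h2] with f hf
  obtain ⟨f₀, h0, l, rfl⟩ := exists_mem_baseBand hw f
  exact hf l (by simpa using h0)

end Fibers

/-! ### Rearrangement of spectral gains -/

section Gain

/-- The power of a component of power `s` that is recovered from an observation with
signal-to-noise ratio `γ`. -/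
noncomputable def gain (s γ : ℝ) : ℝ := s ^ 2 * γ / (1 + s * γ)

lemma gain_nonneg {s γ : ℝ} (hs : 0 ≤ s) (hγ : 0 ≤ γ) : 0 ≤ gain s γ := by
  unfold gain; positivity

lemma gain_le {s γ : ℝ} (hs : 0 ≤ s) (hγ : 0 ≤ γ) : gain s γ ≤ s := by
  unfold gain
  rw [div_le_iff₀ (by positivity)]
  nlinarith

lemma integrable_gain_density {s γ : ℝ} (hγ : 0 ≤ γ) :
    Integrable ((Set.Ioc 0 s).indicator fun u => 1 - 1 / (1 + u * γ) ^ 2) := by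
  rw [integrable_indicator_iff measurableSet_Ioc]
  refine IntegrableOn.mono_set ?_ Set.Ioc_subset_Icc_self
  refine ContinuousOn.integrableOn_Icc ?_
  refine continuousOn_const.sub (continuousOn_const.div (by fun_prop) fun u hu => ?_)
  have : 0 ≤ u * γ := mul_nonneg hu.1 hγ
  positivity

/-- A primitive of the integrand is `u - u / (1 + u γ)`. This form separates the variables: `s`
enters only through the threshold `u ≤ s`, and the integrand increases with `γ`. -/
lemma gain_eq_integral {s γ : ℝ} (hs : 0 ≤ s) (hγ : 0 ≤ γ) :
    gain s γ = ∫ u, (Set.Ioc 0 s).indicator (fun u => 1 - 1 / (1 + u * γ) ^ 2) u := by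
  rw [integral_indicator measurableSet_Ioc, ← intervalIntegral.integral_of_le hs]
  have hd : ∀ u ∈ Set.uIcc 0 s,
      HasDerivAt (fun u => u - u / (1 + u * γ)) (1 - 1 / (1 + u * γ) ^ 2) u := by
    intro u hu
    rw [Set.uIcc_of_le hs] at hu
    have h0 : 0 ≤ u * γ := mul_nonneg hu.1 hγ
    have h1 : (1 + u * γ) ≠ 0 := by positivity
    have h2 : HasDerivAt (fun u => 1 + u * γ) γ u := by
      simpa using ((hasDerivAt_id u).mul_const γ).const_add 1
    convert! (hasDerivAt_id' u).sub ((hasDerivAt_id' u).div h2 h1) using 1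
    field_simp
    ring
  rw [intervalIntegral.integral_eq_sub_of_hasDerivAt hd]
  · have h1 : (1 + s * γ) ≠ 0 := by positivity
    unfold gain
    field_simp
    ring
  · rw [intervalIntegrable_iff_integrableOn_Ioc_of_le hs, ← integrable_indicator_iff
      measurableSet_Ioc]
    exact integrable_gain_density hγ

/-- Bathtub principle: with `c` the minimum of `ψ` over the selected indices, `ω ψ ≤ ω c + (ψ - c)`
on them and `ω ψ ≤ ω c` elsewhere, and the total weight is at most `A.card`. -/
lemma sum_mul_le_sum_of_threshold {M : ℕ} {m : Fin M → ℤ} (hm : Function.Injective m)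
    {F : Finset ℤ} {ω ψ : ℤ → ℝ} {A : Finset (Fin M)} (hω0 : ∀ l, 0 ≤ ω l) (hω1 : ∀ l, ω l ≤ 1)
    (hsum : ∑ l ∈ F, ω l ≤ A.card) (hψ : ∀ l, 0 ≤ ψ l)
    (hA : ∀ k ∈ A, ∀ l, l ∉ A.image m → ψ l ≤ ψ (m k)) :
    ∑ l ∈ F, ω l * ψ l ≤ ∑ k ∈ A, ψ (m k) := by
  rcases A.eq_empty_or_nonempty with rfl | hne
  · simp only [Finset.card_empty, Nat.cast_zero, Finset.sum_empty] at hsum ⊢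
    have h0 := (Finset.sum_eq_zero_iff_of_nonneg fun l _ => hω0 l).1
      (le_antisymm hsum (Finset.sum_nonneg fun l _ => hω0 l))
    exact (Finset.sum_eq_zero fun l hl => by rw [h0 l hl, zero_mul]).le
  · obtain ⟨k₀, hk₀, hmin⟩ := A.exists_min_image (fun k => ψ (m k)) hne
    set c := ψ (m k₀) with hc
    have hc0 : 0 ≤ c := hψ _
    have hB : ∀ l ∈ A.image m, c ≤ ψ l := by
      intro l hl
      obtain ⟨k, hk, rfl⟩ := Finset.mem_image.1 hl
      exact hmin k hk
    calc ∑ l ∈ F, ω l * ψ l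
        ≤ ∑ l ∈ F, (ω l * c + if l ∈ A.image m then ψ l - c else 0) := by
          refine Finset.sum_le_sum fun l _ => ?_
          split_ifs with h
          · have := hB l h
            nlinarith [hω1 l]
          · have := hA k₀ hk₀ l h
            nlinarith [hω0 l]
      _ = (∑ l ∈ F, ω l) * c + ∑ l ∈ F with l ∈ A.image m, (ψ l - c) := by
          rw [Finset.sum_add_distrib, Finset.sum_mul, Finset.sum_filter]
      _ ≤ A.card * c + ∑ l ∈ A.image m, (ψ l - c) := by
          gcongr
          · intro l hl _
            linarith [hB l hl]
          · intro l hl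
            exact (Finset.mem_filter.1 hl).2
      _ = ∑ k ∈ A, ψ (m k) := by
          rw [Finset.sum_image hm.injOn, Finset.sum_sub_distrib]
          simp

/-- Layer cake in the power variable: at each level `u` only indices with power at least `u` count,
and the bathtub principle applies to the integrands. -/
lemma sum_mul_gain_le {M : ℕ} {m : Fin M → ℤ} (hm : Function.Injective m) {s γ : ℤ → ℝ}
    (hs : ∀ l, 0 ≤ s l) (hγ : ∀ l, 0 ≤ γ l)
    (hs_anti : Antitone fun k => s (m k)) (hγ_anti : Antitone fun k => γ (m k))
    (hs_dom : ∀ l, l ∉ Set.range m → ∀ k, s l ≤ s (m k))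
    (hγ_dom : ∀ l, l ∉ Set.range m → ∀ k, γ l ≤ γ (m k)) (σ : Equiv.Perm ℤ)
    {F : Finset ℤ} {ω : ℤ → ℝ} (hω0 : ∀ l, 0 ≤ ω l) (hω1 : ∀ l, ω l ≤ 1)
    (hsum : ∑ l ∈ F, ω l ≤ M) :
    ∑ l ∈ F, ω l * gain (s (σ l)) (γ l) ≤ ∑ k, gain (s (m k)) (γ (m k)) := by
  simp_rw [gain_eq_integral (hs _) (hγ _), ← integral_const_mul]
  rw [← integral_finsetSum _ fun l _ => (integrable_gain_density (hγ l)).const_mul _,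
    ← integral_finsetSum _ fun k _ => integrable_gain_density (hγ _)]
  refine integral_mono
    (integrable_finsetSum _ fun l _ => (integrable_gain_density (hγ l)).const_mul _)
    (integrable_finsetSum _ fun k _ => integrable_gain_density (hγ _)) fun u => ?_
  simp only [Set.indicator_apply, Set.mem_Ioc]
  by_cases hu : 0 < u
  swap
  · simp [hu]
  simp only [hu, true_and]
  set ψ : ℤ → ℝ := fun l => 1 - 1 / (1 + u * γ l) ^ 2 with hψdef
  have hψmono : ∀ l l', γ l ≤ γ l' → ψ l ≤ ψ l' := by
    intro l l' h
    have h0 := hγ l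
    simp only [hψdef]
    gcongr
  have hψ0 : ∀ l, 0 ≤ ψ l := by
    intro l
    simp only [hψdef, sub_nonneg]
    rw [div_le_one (by have := hγ l; positivity)]
    have := mul_nonneg hu.le (hγ l)
    nlinarith
  set A : Finset (Fin M) := Finset.univ.filter fun k => u ≤ s (m k) with hAdef
  have key := sum_mul_le_sum_of_threshold hm (F := F) (A := A) (ψ := ψ)
    (ω := fun l => if u ≤ s (σ l) then ω l else 0)
    (fun l => by split_ifs; exacts [hω0 l, le_rfl])
    (fun l => by split_ifs; exacts [hω1 l, zero_le_one]) ?_ hψ0 ?_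
  · rw [hAdef, Finset.sum_filter] at key
    refine le_trans (le_of_eq (Finset.sum_congr rfl fun l _ => ?_)) key
    split_ifs <;> simp [hψdef]
  -- If every selected power reaches `u`, the budget `M` suffices. Otherwise some selected power is
  -- below `u`, so domination puts every index of power at least `u` among the selected ones, and
  -- `σ` injects the contributing `l` into the image of `A`.
  · by_cases hA : A = Finset.univ
    · rw [hA, Finset.card_univ, Fintype.card_fin]
      refine le_trans (Finset.sum_le_sum fun l _ => ?_) hsum
      split_ifs
      exacts [le_rfl, hω0 l]
    · obtain ⟨k₀, hk₀⟩ : ∃ k, k ∉ A := by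
        by_contra! h
        exact hA (Finset.eq_univ_iff_forall.2 h)
      have hk₀' : s (m k₀) < u := by simpa [hAdef] using hk₀
      have hsub : (F.filter fun l => u ≤ s (σ l)).image σ ⊆ A.image m := by
        intro l hl
        obtain ⟨l, hlF, rfl⟩ := Finset.mem_image.1 hl
        have hl := (Finset.mem_filter.1 hlF).2
        by_cases hr : σ l ∈ Set.range m
        · obtain ⟨k, hk⟩ := hr
          rw [← hk]
          refine Finset.mem_image_of_mem _ ?_
          simpa [hAdef, hk] using hl
        · exact absurd (hs_dom _ hr k₀) (by linarith)
      have hcard := Finset.card_le_card hsub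
      rw [Finset.card_image_of_injective _ σ.injective, Finset.card_image_of_injective _ hm]
        at hcard
      calc ∑ l ∈ F, (if u ≤ s (σ l) then ω l else 0)
          = ∑ l ∈ F with u ≤ s (σ l), ω l := (Finset.sum_filter _ _).symm
        _ ≤ ∑ l ∈ F with u ≤ s (σ l), (1 : ℝ) := Finset.sum_le_sum fun l _ => hω1 l
        _ = ((F.filter fun l => u ≤ s (σ l)).card : ℝ) := by simp
        _ ≤ A.card := by exact_mod_cast hcard
  -- The set `A` is an initial segment of `Fin M`, because the selected powers decrease; hence it
  -- also carries the largest ratios.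
  · intro k hk l hl
    refine hψmono _ _ ?_
    by_cases hr : l ∈ Set.range m
    · obtain ⟨k', rfl⟩ := hr
      refine hγ_anti ?_
      have hk' : k' ∉ A := fun h => hl (Finset.mem_image_of_mem _ h)
      simp only [hAdef, Finset.mem_filter, Finset.mem_univ, true_and, not_le] at hk hk'
      by_contra! hlt
      have := hs_anti hlt.le
      simp only at this
      linarith
    · exact hγ_dom l hr k

end Gain

/-! ### Linear estimation on one aliased set -/

section Square

variable {s n : ℝ} {H e : ℂ}

lemma gain_snr_eq (hs : 0 ≤ s) (hn : 0 ≤ n) (hnH : n = 0 → H = 0) :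
    gain s (‖H‖ ^ 2 / n) = s ^ 2 * ‖H‖ ^ 2 / (‖H‖ ^ 2 * s + n) := by
  rcases hn.eq_or_lt with h0 | h0
  · simp [hnH h0.symm, gain]
  · unfold gain
    have : n + s * ‖H‖ ^ 2 ≠ 0 := by positivity
    have : ‖H‖ ^ 2 * s + n ≠ 0 := by positivity
    field_simp
    ring

lemma mul_norm_wiener_sq (hs : 0 ≤ s) (hn : 0 ≤ n) (hnH : n = 0 → H = 0) :
    (‖H‖ ^ 2 * s + n) * ‖(s * conj H / (‖H‖ ^ 2 * s + n : ℝ) : ℂ)‖ ^ 2 =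
      gain s (‖H‖ ^ 2 / n) := by
  rw [gain_snr_eq hs hn hnH]
  have hq : 0 ≤ ‖H‖ ^ 2 * s + n := by positivity
  rw [norm_div, norm_mul, RCLike.norm_conj, norm_real, norm_real, Real.norm_of_nonneg hs,
    Real.norm_of_nonneg hq]
  rcases hq.eq_or_lt with h0 | h0
  -- With zero output power the Wiener coefficient is a division by zero, so both sides are `0`.
  · simp [← h0]
  · field_simp

/-- Completing the square in the error of a linear estimate. -/
lemma norm_sub_sq_add_eq (hs : 0 ≤ s) (hn : 0 ≤ n) (hnH : n = 0 → H = 0) (he : ‖e‖ = 1) (g : ℂ) :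
    ‖e - H * g‖ ^ 2 * s + ‖g‖ ^ 2 * n =
      (‖H‖ ^ 2 * s + n) * ‖g - e * (s * conj H / (‖H‖ ^ 2 * s + n : ℝ))‖ ^ 2 +
        (s - gain s (‖H‖ ^ 2 / n)) := by
  rcases hn.eq_or_lt with h0 | h0
  · simp [hnH h0.symm, gain, ← h0, he]
  have hq : 0 < ‖H‖ ^ 2 * s + n := by positivity
  rw [gain_snr_eq hs hn hnH]
  obtain ⟨ρ, hρ⟩ : ∃ ρ : ℝ, ρ = s / (‖H‖ ^ 2 * s + n) := ⟨_, rfl⟩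
  have h1 : (s * conj H / (‖H‖ ^ 2 * s + n : ℝ) : ℂ) = ρ * conj H := by
    rw [hρ]; push_cast; ring
  have h2 : s ^ 2 * ‖H‖ ^ 2 / (‖H‖ ^ 2 * s + n) = s * ρ * ‖H‖ ^ 2 := by
    rw [hρ]; ring
  have h3 : (‖H‖ ^ 2 * s + n) * ρ = s := by rw [hρ]; field_simp
  rw [h1, h2]
  have he2 : ‖e‖ ^ 2 = 1 := by rw [he]; norm_num
  have hH2 : ‖H‖ ^ 2 = H.re * H.re + H.im * H.im := by rw [Complex.sq_norm, normSq_apply]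
  rw [Complex.sq_norm, normSq_apply] at he2
  rw [hH2] at h3 ⊢
  simp only [Complex.sq_norm, normSq_apply, sub_re, sub_im, mul_re, mul_im, conj_re, conj_im, ofReal_re,
    ofReal_im]
  -- In real coordinates the identity follows from `|e|² = 1` and `(|H|² s + n) ρ = s` alone.
  linear_combination (s - ((H.re * H.re + H.im * H.im) * s + n) * ρ ^ 2 *
    (H.re * H.re + H.im * H.im)) * he2 + (2 * (e.re * (H.re * g.re - H.im * g.im) +
      e.im * (H.re * g.im + H.im * g.re)) - ρ * (H.re * H.re + H.im * H.im)) * h3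

end Square

/-! ### Averaging over orthogonal phases -/

section Average

variable {ι : Type*} [Fintype ι] [DecidableEq ι]

/-- Parseval: orthogonality of the phases in `j` removes all cross terms between distinct
frequencies. -/
lemma sum_norm_sum_sq {N : ℕ} {e : ℕ → ι → ℂ}
    (he : ∀ l l', ∑ j ∈ Finset.range N, conj (e j l) * e j l' = if l = l' then (N : ℂ) else 0)
    (a : ι → ℂ) :
    ∑ j ∈ Finset.range N, ‖∑ l, e j l * a l‖ ^ 2 = N * ∑ l, ‖a l‖ ^ 2 := by
  have h : (∑ j ∈ Finset.range N, ((‖∑ l, e j l * a l‖ ^ 2 : ℝ) : ℂ)) =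
      N * ∑ l, ((‖a l‖ ^ 2 : ℝ) : ℂ) := by
    calc ∑ j ∈ Finset.range N, ((‖∑ l, e j l * a l‖ ^ 2 : ℝ) : ℂ)
        = ∑ j ∈ Finset.range N, ∑ l, ∑ l', conj (a l) * a l' * (conj (e j l) * e j l') := by
          refine Finset.sum_congr rfl fun j _ => ?_
          rw [ofReal_pow, ← conj_mul', map_sum, Finset.sum_mul_sum]
          refine Finset.sum_congr rfl fun l _ => Finset.sum_congr rfl fun l' _ => ?_
          rw [map_mul]; ring
      _ = ∑ l, ∑ l', conj (a l) * a l' * ∑ j ∈ Finset.range N, conj (e j l) * e j l' := by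
          rw [Finset.sum_comm]
          refine Finset.sum_congr rfl fun l _ => ?_
          rw [Finset.sum_comm]
          simp_rw [Finset.mul_sum]
      _ = N * ∑ l, ((‖a l‖ ^ 2 : ℝ) : ℂ) := by
          simp_rw [he, mul_ite, mul_zero, Finset.sum_ite_eq, Finset.mem_univ, if_true, conj_mul',
            Finset.mul_sum, ofReal_pow, mul_comm]
  exact_mod_cast h

/-- A subspace of dimension at most `M` captures, on average over an orthogonal family of phase
vectors `e j`, a fraction `ω l` of the `l`-th coordinate, with `∑ ω l ≤ M`. -/
lemma exists_weights_of_finrank_le {M N : ℕ} {e : ℕ → ι → ℂ}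
    (he : ∀ l l', ∑ j ∈ Finset.range N, conj (e j l) * e j l' = if l = l' then (N : ℂ) else 0)
    (b : ι → ℂ) (W : Submodule ℂ (EuclideanSpace ℂ ι)) (hW : Module.finrank ℂ W ≤ M)
    {h : ℕ → EuclideanSpace ℂ ι} (hh : ∀ j, h j ∈ W) (he1 : ∀ j l, ‖e j l‖ = 1) :
    ∃ ω : ι → ℝ, (∀ l, 0 ≤ ω l) ∧ (∀ l, ω l ≤ 1) ∧ ∑ l, ω l ≤ M ∧
      N * ∑ l, ‖b l‖ ^ 2 * (1 - ω l) ≤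
        ∑ j ∈ Finset.range N, ∑ l, ‖h j l - e j l * b l‖ ^ 2 := by
  set u := stdOrthonormalBasis ℂ W with hu
  have huo : Orthonormal ℂ fun i => (u i : EuclideanSpace ℂ ι) :=
    u.orthonormal.comp_linearIsometry W.subtypeₗᵢ
  set z : ℕ → EuclideanSpace ℂ ι := fun j => WithLp.toLp 2 fun l => e j l * b l with hz
  have hnorm : ∀ j, ‖z j‖ ^ 2 = ∑ l, ‖b l‖ ^ 2 := fun j => by
    rw [EuclideanSpace.norm_sq_eq]
    simp [hz, he1]
  -- The weight `ω l` is the squared norm of the projection of the `l`-th unit vector onto `W`: at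
  -- most `1` by Bessel, and of total `dim W`.
  refine ⟨fun l => ∑ i, ‖(u i : EuclideanSpace ℂ ι) l‖ ^ 2, fun l => by positivity, fun l => ?_,
    ?_, ?_⟩
  · have := huo.sum_inner_products_le (EuclideanSpace.single l (1 : ℂ)) (s := Finset.univ)
    simpa [EuclideanSpace.inner_single_right] using this
  · rw [Finset.sum_comm]
    have h1 : ∀ i, ∑ l, ‖(u i : EuclideanSpace ℂ ι) l‖ ^ 2 = 1 := fun i => by
      rw [← EuclideanSpace.norm_sq_eq, huo.1 i, one_pow]
    simp_rw [h1]
    simpa using hW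
  · have h1 : ∀ j, ∑ l, ‖b l‖ ^ 2 - ∑ i, ‖inner ℂ (u i : EuclideanSpace ℂ ι) (z j)‖ ^ 2 ≤
        ∑ l, ‖h j l - e j l * b l‖ ^ 2 := fun j => by
      have e1 : ∑ l, ‖h j l - e j l * b l‖ ^ 2 = ‖z j - h j‖ ^ 2 := by
        rw [norm_sub_rev, EuclideanSpace.norm_sq_eq]
        simp [hz]
      have e2 : ∑ i, ‖inner ℂ (u i : EuclideanSpace ℂ ι) (z j)‖ ^ 2 =
          ‖W.starProjection (z j)‖ ^ 2 := by
        have := u.sum_sq_norm_inner_right (W.orthogonalProjectionOnto (z j))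
        rw [Submodule.starProjection_apply, ← Submodule.coe_norm, ← this]
        refine Finset.sum_congr rfl fun i _ => ?_
        rw [Submodule.inner_orthogonalProjectionOnto_eq_of_mem_left]
      have e3 : ‖z j‖ ^ 2 = ‖W.starProjection (z j)‖ ^ 2 + ‖z j - W.starProjection (z j)‖ ^ 2 := by
        have h0 : inner ℂ (W.starProjection (z j)) (z j - W.starProjection (z j)) = 0 :=
          (Submodule.mem_orthogonal _ _).1 (Submodule.sub_starProjection_mem_orthogonal (z j)) _
            (Submodule.starProjection_apply_mem _ _)
        have := @norm_add_sq ℂ _ _ _ _ (W.starProjection (z j)) (z j - W.starProjection (z j))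
        rw [h0] at this
        simpa using this
      have e4 : ‖z j - W.starProjection (z j)‖ ≤ ‖z j - h j‖ := by
        rw [Submodule.starProjection_minimal]
        exact ciInf_le ⟨0, by rintro _ ⟨_, rfl⟩; positivity⟩ (⟨_, hh j⟩ : W)
      rw [e1, e2, ← hnorm j, e3]
      have := pow_le_pow_left₀ (norm_nonneg _) e4 2
      linarith
    -- Parseval over the phases: only the diagonal terms of the captured energy survive.
    have h2 : ∀ i, ∑ j ∈ Finset.range N, ‖inner ℂ (u i : EuclideanSpace ℂ ι) (z j)‖ ^ 2 =
        N * ∑ l, ‖b l‖ ^ 2 * ‖(u i : EuclideanSpace ℂ ι) l‖ ^ 2 := fun i => by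
      have := sum_norm_sum_sq he fun l => b l * conj ((u i : EuclideanSpace ℂ ι) l)
      simp_rw [norm_mul, RCLike.norm_conj, mul_pow] at this
      rw [← this]
      refine Finset.sum_congr rfl fun j _ => ?_
      simp [PiLp.inner_apply, hz, mul_assoc]
    refine le_trans (le_of_eq ?_) (Finset.sum_le_sum fun j _ => h1 j)
    have h3 : ∑ j ∈ Finset.range N, ∑ i, ‖inner ℂ (u i : EuclideanSpace ℂ ι) (z j)‖ ^ 2 =
        N * ∑ l, ‖b l‖ ^ 2 * ∑ i, ‖(u i : EuclideanSpace ℂ ι) l‖ ^ 2 := by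
      rw [Finset.sum_comm, Finset.sum_congr rfl fun i _ => h2 i, ← Finset.mul_sum, Finset.sum_comm]
      simp_rw [Finset.mul_sum]
    rw [Finset.sum_sub_distrib, h3, Finset.sum_const, Finset.card_range, nsmul_eq_mul, ← mul_sub,
      ← Finset.sum_sub_distrib]
    simp_rw [mul_sub, mul_one]

/-- Linear estimation with `M` filters of `N` phase-shifted inputs on finitely many frequencies. -/
lemma exists_weights_le_sum_error {M N : ℕ} {e : ℕ → ι → ℂ}
    (he : ∀ l l', ∑ j ∈ Finset.range N, conj (e j l) * e j l' = if l = l' then (N : ℂ) else 0)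
    (he1 : ∀ j l, ‖e j l‖ = 1) {s n : ι → ℝ} {H : ι → ℂ} (hs : ∀ l, 0 ≤ s l) (hn : ∀ l, 0 ≤ n l)
    (hnH : ∀ l, n l = 0 → H l = 0) (V : Fin M → ι → ℂ) (p : ℕ → Fin M → ℂ) :
    ∃ ω : ι → ℝ, (∀ l, 0 ≤ ω l) ∧ (∀ l, ω l ≤ 1) ∧ ∑ l, ω l ≤ M ∧
      N * ∑ l, (s l - ω l * gain (s l) (‖H l‖ ^ 2 / n l)) ≤
        ∑ j ∈ Finset.range N, ∑ l, (‖e j l - H l * ∑ k, p j k * V k l‖ ^ 2 * s l +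
          ‖∑ k, p j k * V k l‖ ^ 2 * n l) := by
  set q : ι → ℝ := fun l => ‖H l‖ ^ 2 * s l + n l with hq
  have hq0 : ∀ l, 0 ≤ q l := fun l => by have := hs l; have := hn l; positivity
  set r : ι → ℂ := fun l => s l * conj (H l) / (‖H l‖ ^ 2 * s l + n l : ℝ) with hr
  -- Scaling coordinates by `√q` makes the weighted error a Euclidean distance; the scaled Wiener
  -- target has squared coordinates equal to the gains.
  set U : Fin M → EuclideanSpace ℂ ι := fun k => WithLp.toLp 2 fun l => √(q l) * V k l with hU
  have hsq : ∀ l, ‖((√(q l) : ℝ) : ℂ)‖ ^ 2 = q l := fun l => by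
    rw [norm_real, Real.norm_of_nonneg (Real.sqrt_nonneg _), Real.sq_sqrt (hq0 l)]
  obtain ⟨ω, h0, h1, h2, h3⟩ := exists_weights_of_finrank_le (M := M) he (fun l => √(q l) * r l)
    (Submodule.span ℂ (Set.range U)) ((finrank_range_le_card U).trans (by simp))
    (h := fun j => ∑ k, p j k • U k) (fun j => Submodule.sum_mem _ fun k _ =>
      Submodule.smul_mem _ _ (Submodule.subset_span ⟨k, rfl⟩)) he1
  refine ⟨ω, h0, h1, h2, ?_⟩
  have hb : ∀ l, ‖(√(q l) * r l : ℂ)‖ ^ 2 = gain (s l) (‖H l‖ ^ 2 / n l) := fun l => by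
    rw [norm_mul, mul_pow, hsq, hr]
    exact mul_norm_wiener_sq (hs l) (hn l) (hnH l)
  simp_rw [hb] at h3
  have hterm : ∀ j l, ‖e j l - H l * ∑ k, p j k * V k l‖ ^ 2 * s l +
      ‖∑ k, p j k * V k l‖ ^ 2 * n l =
      ‖(∑ k, p j k • U k : EuclideanSpace ℂ ι) l - e j l * (√(q l) * r l)‖ ^ 2 +
        (s l - gain (s l) (‖H l‖ ^ 2 / n l)) := fun j l => by
    rw [norm_sub_sq_add_eq (hs l) (hn l) (hnH l) (he1 j l)]
    have : (∑ k, p j k • U k : EuclideanSpace ℂ ι) l - e j l * (√(q l) * r l) =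
        √(q l) * ((∑ k, p j k * V k l) - e j l * r l) := by
      simp only [WithLp.ofLp_sum, WithLp.ofLp_smul, Finset.sum_apply, Pi.smul_apply, hU,
        smul_eq_mul, mul_sub, Finset.mul_sum]
      congr 1
      · exact Finset.sum_congr rfl fun k _ => by ring
      · ring
    rw [this, norm_mul, mul_pow, hsq]
  simp_rw [hterm, Finset.sum_add_distrib]
  rw [Finset.sum_const, Finset.card_range, nsmul_eq_mul]
  refine le_trans (le_of_eq ?_) (add_le_add_left h3 _)
  rw [← mul_add, ← Finset.sum_add_distrib]
  congr 1
  exact Finset.sum_congr rfl fun l _ => by ring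

end Average

/-! ### Phases on an aliased set -/

section Phases

lemma expo_alias {w T : ℝ} (hwT : w * T = 1) (n : ℤ) (f : ℝ) (l : ℤ) :
    expo (n * T) (f - l * w) = expo (n * T) f := by
  have hwT' : (w : ℂ) * T = 1 := by exact_mod_cast hwT
  rw [expo, expo, Complex.exp_eq_exp_iff_exists_int]
  refine ⟨-(n * l), ?_⟩
  push_cast
  linear_combination -(2 * Real.pi * I * n * l) * hwT'

/-- Successive terms differ by the factor `ζ = exp(2πi(l - l')/N)`, an `N`-th root of unity. It is
not `1` when `0 < |l - l'| < N`, so the geometric sum vanishes. -/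
lemma sum_conj_expo_mul_expo {w T : ℝ} (hwT : w * T = 1) {N : ℕ} (hN : 0 < N) (τ f : ℝ) {l l' : ℤ}
    (hl : |l - l'| < N) :
    ∑ j ∈ Finset.range N, conj (expo (τ + j * (T / N)) (f - l * w)) *
      expo (τ + j * (T / N)) (f - l' * w) = if l = l' then (N : ℂ) else 0 := by
  split_ifs with h
  · subst h
    simp [conj_mul', norm_expo]
  · have hN' : (N : ℂ) ≠ 0 := by exact_mod_cast hN.ne'
    have hwT' : (w : ℂ) * T = 1 := by exact_mod_cast hwT
    set ζ : ℂ := cexp (2 * Real.pi * I * (l - l') / N) with hζ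
    have hterm : ∀ j : ℕ, conj (expo (τ + j * (T / N)) (f - l * w)) *
        expo (τ + j * (T / N)) (f - l' * w) =
          cexp (2 * Real.pi * I * (l - l') * w * τ) * ζ ^ j := fun j => by
      rw [conj_expo, expo, expo, hζ, ← Complex.exp_nat_mul, ← Complex.exp_add, ← Complex.exp_add]
      congr 1
      push_cast
      field_simp
      linear_combination ((l - l') * j) * hwT'
    have hζ1 : ζ ≠ 1 := by
      intro h1
      obtain ⟨m, hm⟩ := Complex.exp_eq_one_iff.1 h1
      have h2pi : (2 * Real.pi * I : ℂ) ≠ 0 := Complex.two_pi_I_ne_zero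
      have h3 : ((l - l' : ℤ) : ℂ) = ((m * N : ℤ) : ℂ) := by
        push_cast
        field_simp at hm
        rw [hm, mul_comm]
      have h4 : l - l' = m * N := by exact_mod_cast h3
      have := Int.eq_zero_of_abs_lt_dvd (Dvd.intro_left m h4.symm) hl
      exact h (by linarith)
    have hζN : ζ ^ N = 1 := by
      rw [hζ, ← Complex.exp_nat_mul, Complex.exp_eq_one_iff]
      refine ⟨l - l', ?_⟩
      push_cast
      field_simp
    simp_rw [hterm]
    rw [← Finset.mul_sum, geom_sum_eq hζ1, hζN]
    simp

/-- The coefficients `p` do not depend on `l`: this is where the dimension bound `M` on each aliased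
set comes from. -/
lemma combination_alias {M : ℕ} {w T : ℝ} (hwT : w * T = 1) (S : Fin M → ℝ → ℂ)
    (c : Fin M × ℤ →₀ ℂ) (f : ℝ) : ∃ p : Fin M → ℂ, ∀ l : ℤ,
      combination T S c (f - l * w) = ∑ k, p k * S k (f - l * w) := by
  refine ⟨fun k => ∑ q ∈ c.support with q.1 = k, c q * expo (q.2 * T) f, fun l => ?_⟩
  rw [combination, ← Finset.sum_fiberwise c.support fun q => q.1]
  refine Finset.sum_congr rfl fun k _ => ?_
  rw [Finset.sum_mul]
  refine Finset.sum_congr rfl fun q hq => ?_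
  rw [expo_alias hwT, (Finset.mem_filter.1 hq).2]
  ring

/-- The number of instants equals the size `2L + 1` of the window, so indices in it differ by less
than that number and the phases are orthogonal. -/
lemma exists_weights_alias {M : ℕ} {w T : ℝ} (hwT : w * T = 1) {H : ℝ → ℂ} {SX Sη : ℝ → ℝ}
    (hSX : ∀ f, 0 ≤ SX f) (hSη : ∀ f, 0 ≤ Sη f) (hzero : ∀ f, Sη f = 0 → H f = 0)
    (S : Fin M → ℝ → ℂ) (L : ℕ) (τ : ℝ) (c : ℕ → Fin M × ℤ →₀ ℂ) (f : ℝ) :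
    ∃ ω : ℤ → ℝ, (∀ l, 0 ≤ ω l) ∧ (∀ l, ω l ≤ 1) ∧ ∑ l ∈ Finset.Icc (-L : ℤ) L, ω l ≤ M ∧
      (2 * L + 1 : ℕ) * ∑ l ∈ Finset.Icc (-L : ℤ) L,
        (SX (f - l * w) - ω l * gain (SX (f - l * w)) (snr H Sη (f - l * w))) ≤
      ∑ j ∈ Finset.range (2 * L + 1), ∑ l ∈ Finset.Icc (-L : ℤ) L,
        (‖expo (τ + j * (T / (2 * L + 1 : ℕ))) (f - l * w) -
            H (f - l * w) * combination T S (c j) (f - l * w)‖ ^ 2 * SX (f - l * w) +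
          ‖combination T S (c j) (f - l * w)‖ ^ 2 * Sη (f - l * w)) := by
  choose p hp using fun j => combination_alias hwT S (c j) f
  obtain ⟨ω, h0, h1, h2, h3⟩ := exists_weights_le_sum_error (ι := Finset.Icc (-L : ℤ) L)
    (N := 2 * L + 1) (M := M)
    (e := fun j l => expo (τ + j * (T / (2 * L + 1 : ℕ))) (f - (l : ℤ) * w)) (fun l l' => by
      have hl := Finset.mem_Icc.1 l.2
      have hl' := Finset.mem_Icc.1 l'.2
      rw [sum_conj_expo_mul_expo hwT (by positivity)]
      · simp only [Subtype.ext_iff]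
      · rw [abs_lt]
        push_cast
        constructor <;> linarith)
    (fun j l => norm_expo _ _) (s := fun l => SX (f - (l : ℤ) * w))
    (n := fun l => Sη (f - (l : ℤ) * w)) (H := fun l => H (f - (l : ℤ) * w))
    (fun l => hSX _) (fun l => hSη _) (fun l => hzero _) (fun k l => S k (f - (l : ℤ) * w)) p
  refine ⟨fun l => if h : l ∈ Finset.Icc (-L : ℤ) L then ω ⟨l, h⟩ else 0, fun l => ?_, fun l => ?_,
    ?_, ?_⟩
  · dsimp only; split_ifs
    exacts [h0 _, le_rfl]
  · dsimp only; split_ifs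
    exacts [h1 _, zero_le_one]
  · rw [← Finset.sum_coe_sort]
    simpa using h2
  · simp_rw [← Finset.sum_coe_sort (Finset.Icc (-L : ℤ) L), hp]
    simpa [snr] using h3

end Phases

/-! ### Attainability with the optimal bank -/

lemma fourier_eq_expo {w T : ℝ} (hwT : w * T = 1) (n : ℤ) (f : ℝ) :
    fourier n (f : AddCircle w) = expo (n * T) f := by
  have hw : (w : ℂ) ≠ 0 := by
    intro h
    rw [ofReal_eq_zero] at h
    simp [h] at hwT
  have hwT' : (w : ℂ) * T = 1 := by exact_mod_cast hwT
  rw [fourier_coe_apply, expo]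
  congr 1
  rw [div_eq_iff hw]
  push_cast
  linear_combination -(2 * Real.pi * I * n * f) * hwT'

/-- Trigonometric polynomials are dense among the periodic functions in `L²(μ)`. -/
lemma exists_trigonometric_approx {w T : ℝ} [Fact (0 < w)] (hwT : w * T = 1) (μ : Measure ℝ)
    [IsFiniteMeasure μ] {r : AddCircle w → ℂ} (hr : Measurable r)
    (hr2 : ∫⁻ f, ENNReal.ofReal (‖r (f : AddCircle w)‖ ^ 2) ∂μ < ∞) {ε : ℝ} (hε : 0 < ε) :
    ∃ c : ℤ →₀ ℂ, ∫⁻ f, ENNReal.ofReal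
      (‖(∑ n ∈ c.support, c n * expo (n * T) f) - r (f : AddCircle w)‖ ^ 2) ∂μ ≤
        ENNReal.ofReal ε := by
  set ν : Measure (AddCircle w) := μ.map (fun f : ℝ => (f : AddCircle w)) with hν
  have hmk : Measurable fun f : ℝ => (f : AddCircle w) := AddCircle.measurable_mk'
  have hfin : IsFiniteMeasure ν := inferInstance
  have hrL : MemLp r 2 ν := by
    refine memLp_two_of_lintegral hr.aestronglyMeasurable ?_
    rwa [hν, lintegral_map (hr.norm.pow_const 2).ennreal_ofReal hmk]
  -- Trigonometric polynomials are uniformly dense in the continuous functions on the circle, which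
  -- are dense in `L²` of the pushforward of `μ`.
  have hdense := (ContinuousMap.toLp_denseRange ℂ ν ℂ
    (p := 2) (by norm_num)).topologicalClosure_map_submodule (span_fourier_closure_eq_top (T := w))
  have hmem : hrL.toLp r ∈ (Submodule.map (ContinuousMap.toLp 2 ν ℂ).toLinearMap
      (Submodule.span ℂ (Set.range (fourier (T := w))))).topologicalClosure := by
    rw [hdense]; trivial
  obtain ⟨_, ⟨F, hF, rfl⟩, hdist⟩ := Metric.mem_closure_iff.1 hmem (√ε) (Real.sqrt_pos.2 hε)
  obtain ⟨c, rfl⟩ := Finsupp.mem_span_range_iff_exists_finsupp.1 hF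
  refine ⟨c, ?_⟩
  set F : C(AddCircle w, ℂ) := c.sum fun n a => a • fourier n with hFdef
  have hFL : MemLp F 2 ν :=
    MemLp.of_bound F.continuous.measurable.aestronglyMeasurable ‖F‖
      (.of_forall fun θ => F.norm_coe_le_norm θ)
  have hcoe : (ContinuousMap.toLp 2 ν ℂ F : Lp ℂ 2 ν) = hFL.toLp F := by
    refine Lp.ext ?_
    filter_upwards [ContinuousMap.coeFn_toLp (𝕜 := ℂ) (p := 2) ν F, hFL.coeFn_toLp] with θ h1 h2
    rw [h1, h2]
  have hval : ∀ f : ℝ, ∑ n ∈ c.support, c n * expo (n * T) f = F (f : AddCircle w) := fun f => by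
    rw [hFdef, Finsupp.sum, ContinuousMap.sum_apply]
    refine Finset.sum_congr rfl fun n _ => ?_
    rw [ContinuousMap.smul_apply, fourier_eq_expo hwT, smul_eq_mul]
  simp_rw [hval]
  have hm : Measurable fun θ => ENNReal.ofReal (‖F θ - r θ‖ ^ 2) :=
    ((F.continuous.measurable.sub hr).norm.pow_const 2).ennreal_ofReal
  rw [← lintegral_map (f := fun θ => ENNReal.ofReal (‖F θ - r θ‖ ^ 2)) hm hmk, ← hν]
  have := ofReal_norm_toLp_sq (hFL.sub hrL)
  simp only [Pi.sub_apply] at this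
  rw [← this, MemLp.toLp_sub hFL hrL, ← hcoe, norm_sub_rev, ← dist_eq_norm]
  refine ENNReal.ofReal_le_ofReal ?_
  rw [← Real.sq_sqrt hε.le]
  exact pow_le_pow_left₀ dist_nonneg hdist.le 2

/-- Each branch may use its own trigonometric polynomial. -/
lemma exists_combination_eq {M : ℕ} (T : ℝ) (S : Fin M → ℝ → ℂ) (d : Fin M → ℤ →₀ ℂ) :
    ∃ c : Fin M × ℤ →₀ ℂ, ∀ f, combination T S c f =
      ∑ k, S k f * ∑ n ∈ (d k).support, d k n * expo (n * T) f := by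
  classical
  set B : Finset ℤ := Finset.univ.biUnion fun k => (d k).support with hB
  have hmemB : ∀ k n, d k n ≠ 0 → n ∈ B := fun k n h =>
    Finset.mem_biUnion.2 ⟨k, Finset.mem_univ _, Finsupp.mem_support_iff.2 h⟩
  refine ⟨Finsupp.onFinset (Finset.univ ×ˢ B) (fun q => d q.1 q.2) fun q hq =>
    Finset.mem_product.2 ⟨Finset.mem_univ _, hmemB _ _ hq⟩, fun f => ?_⟩
  rw [combination, Finset.sum_subset (s₂ := Finset.univ ×ˢ B) Finsupp.support_onFinset_subset,
    Finset.sum_product]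
  · refine Finset.sum_congr rfl fun k _ => ?_
    rw [Finset.sum_subset (s₁ := (d k).support) (s₂ := B), Finset.mul_sum]
    · refine Finset.sum_congr rfl fun n _ => ?_
      rw [Finsupp.onFinset_apply]
      ring
    · exact fun n hn => hmemB k n (Finsupp.mem_support_iff.1 hn)
    · intro n _ hn
      rw [Finsupp.notMem_support_iff.1 hn, zero_mul]
  · intro q _ hq
    rw [Finsupp.notMem_support_iff.1 hq, zero_mul]

section OptimalBank

variable {M : ℕ} {w : ℝ} {H : ℝ → ℂ} {SX Sη : ℝ → ℝ} {ℓ : Fin M → ℝ → ℤ} {S : Fin M → ℝ → ℂ}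

lemma IsOptimalBank.eq_zero_or_one (hS : IsOptimalBank w H Sη ℓ S) (hw : 0 < w) (k : Fin M)
    (f : ℝ) : S k f = 0 ∨ S k f = 1 := by
  obtain ⟨f₀, h0, l, rfl⟩ := exists_mem_baseBand hw f
  rw [hS.response k f₀ h0 l]
  split_ifs <;> simp

lemma IsOptimalBank.norm_le_one (hS : IsOptimalBank w H Sη ℓ S) (hw : 0 < w) (k : Fin M)
    (f : ℝ) : ‖S k f‖ ≤ 1 := by
  rcases hS.eq_zero_or_one hw k f with h | h <;> simp [h]

lemma IsOptimalBank.ae_disjoint (hS : IsOptimalBank w H Sη ℓ S) (hw : 0 < w) :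
    ∀ᵐ f, ∀ k k', S k f ≠ 0 → S k' f ≠ 0 → k = k' := by
  refine ae_of_ae_baseBand hw ?_
  filter_upwards [hS.selection, ae_restrict_mem (measurableSet_baseBand w)] with f hf hmem l k k'
  rw [hS.response k f hmem, hS.response k' f hmem]
  intro h1 h2
  refine hf.injective ?_
  simp only [ne_eq, ite_eq_right_iff, one_ne_zero, imp_false, not_not] at h1 h2
  exact h1.symm.trans h2

/-- The frequency that the `k`-th filter passes in an aliased set. -/
lemma IsOptimalBank.exists_section (hS : IsOptimalBank w H Sη ℓ S) [hw : Fact (0 < w)]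
    (k : Fin M) : ∃ β : AddCircle w → ℝ, Measurable β ∧ ∀ f : ℝ, S k f ≠ 0 → β f = f := by
  have hIco : Set.Ico (-(w / 2)) (-(w / 2) + w) = baseBand w := by
    rw [baseBand]; congr 1; ring
  -- Measurability of `ℓ` is not assumed; on the base band its level sets are recovered from the
  -- translates of `S k`.
  have hℓ : Measurable fun f : Set.Ico (-(w / 2)) (-(w / 2) + w) => ℓ k f := by
    refine measurable_to_countable' fun l => ?_
    have : (fun f : Set.Ico (-(w / 2)) (-(w / 2) + w) => ℓ k f) ⁻¹' {l} =
        (fun f : Set.Ico (-(w / 2)) (-(w / 2) + w) => S k (f - l * w)) ⁻¹' {0}ᶜ := by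
      ext f
      have := hS.response k f (hIco ▸ f.2) l
      simp only [Set.mem_preimage, Set.mem_singleton_iff, Set.mem_compl_iff, this]
      split_ifs with h <;> simp [h, eq_comm]
    rw [this]
    exact ((hS.measurable k).comp (by fun_prop)) (measurableSet_singleton 0).compl
  have hβ : Measurable fun f : Set.Ico (-(w / 2)) (-(w / 2) + w) => (f : ℝ) - ℓ k f * w :=
    measurable_subtype_coe.sub ((measurable_from_top.comp hℓ).mul_const w)
  refine ⟨fun θ => (fun f : Set.Ico (-(w / 2)) (-(w / 2) + w) => (f : ℝ) - ℓ k f * w)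
    (AddCircle.measurableEquivIco w (-(w / 2)) θ), hβ.comp (MeasurableEquiv.measurable _), ?_⟩
  intro f hf
  obtain ⟨f₀, h0, l, rfl⟩ := exists_mem_baseBand hw.out f
  rw [hS.response k f₀ h0] at hf
  have hl : l = ℓ k f₀ := by simpa using hf
  have hcoe : ((f₀ - l * w : ℝ) : AddCircle w) = (f₀ : AddCircle w) := by
    have : ((l * w : ℝ) : AddCircle w) = 0 := by
      rw [← zsmul_eq_mul, AddCircle.coe_zsmul, AddCircle.coe_period, smul_zero]
    rw [AddCircle.coe_sub, this, sub_zero]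
  have hval : (AddCircle.measurableEquivIco w (-(w / 2)) ((f₀ - l * w : ℝ) : AddCircle w) : ℝ) =
      f₀ := by
    rw [hcoe]
    exact AddCircle.equivIco_coe_of_mem (hIco.symm ▸ h0)
  simp only [hval]
  rw [hl]

/-- The density of the power that the bank `S` recovers. -/
noncomputable def recoveredPower (H : ℝ → ℂ) (SX Sη : ℝ → ℝ) (S : Fin M → ℝ → ℂ) (f : ℝ) : ℝ :=
  ∑ k, ‖S k f‖ ^ 2 * gain (SX f) (snr H Sη f)

lemma snr_nonneg (hSη : ∀ f, 0 ≤ Sη f) (f : ℝ) : 0 ≤ snr H Sη f :=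
  div_nonneg (by positivity) (hSη f)

lemma measurable_snr (hH : Measurable H) (hSη : Measurable Sη) : Measurable (snr H Sη) := by
  unfold snr; fun_prop

lemma measurable_gain (hH : Measurable H) (hSη : Measurable Sη) (hSX : Measurable SX) :
    Measurable fun f => gain (SX f) (snr H Sη f) := by
  have := measurable_snr hH hSη
  unfold gain; fun_prop

lemma measurable_recoveredPower (hH : Measurable H) (hSη : Measurable Sη) (hSX : Measurable SX)
    (hS : ∀ k, Measurable (S k)) : Measurable (recoveredPower H SX Sη S) := by
  have := measurable_gain hH hSη hSX
  unfold recoveredPower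
  fun_prop

lemma recoveredPower_nonneg (hSη : ∀ f, 0 ≤ Sη f) (hSX : ∀ f, 0 ≤ SX f) (f : ℝ) :
    0 ≤ recoveredPower H SX Sη S f :=
  Finset.sum_nonneg fun _ _ => mul_nonneg (by positivity) (gain_nonneg (hSX f) (snr_nonneg hSη f))

lemma IsFilterBank.lintegral_branch_power (hbank : IsFilterBank H SX Sη S) (hX : IsPSD SX)
    (hH : Measurable H) (hSη : Measurable Sη) (hSη_nonneg : ∀ f, 0 ≤ Sη f) (k : Fin M) :
    ∫⁻ f, ENNReal.ofReal (‖S k f‖ ^ 2 * (‖H f‖ ^ 2 * SX f + Sη f)) < ∞ := by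
  have hSk := hbank.measurable k
  have h1 := hbank.signal_power k
  have h2 := hbank.noise_power k
  rw [lintegral_spectralMeasure hX.measurable (by fun_prop) fun f => by positivity] at h1
  rw [lintegral_spectralMeasure hSη (by fun_prop) fun f => by positivity] at h2
  have hX' := hX.measurable
  have : ∫⁻ f, ENNReal.ofReal (‖S k f‖ ^ 2 * (‖H f‖ ^ 2 * SX f + Sη f)) =
      (∫⁻ f, ENNReal.ofReal (‖H f * S k f‖ ^ 2 * SX f)) +
        ∫⁻ f, ENNReal.ofReal (‖S k f‖ ^ 2 * Sη f) := by
    rw [← lintegral_add_left (by fun_prop)]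
    refine lintegral_congr fun f => ?_
    have := hX.nonneg f
    have := hSη_nonneg f
    rw [← ENNReal.ofReal_add (by positivity) (by positivity), norm_mul]
    ring_nf
  rw [this]
  exact ENNReal.add_lt_top.2 ⟨h1, h2⟩

/-- On its pass band, branch `k` needs the response `r`, which agrees there with the periodic
function `r ∘ β k`; this is approximated within `ε / M`. The pass bands are almost everywhere
disjoint, so the branch errors add. Stating the bound as a sum avoids subtraction in `ℝ≥0∞`. -/
theorem exists_combination_lintegral_le {T : ℝ} (hM : 0 < M) (hw : 0 < w) (hwT : w * T = 1)
    (hS : IsOptimalBank w H Sη ℓ S) (hX : IsPSD SX) (hbank : IsFilterBank H SX Sη S)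
    (hH : Measurable H) (hSη : Measurable Sη) (hSη_nonneg : ∀ f, 0 ≤ Sη f)
    (hSη_zero : ∀ f, Sη f = 0 → H f = 0) (t : ℝ) {ε : ℝ} (hε : 0 < ε) :
    ∃ c : Fin M × ℤ →₀ ℂ,
      (∫⁻ f, ENNReal.ofReal (‖expo t f - H f * combination T S c f‖ ^ 2 * SX f +
        ‖combination T S c f‖ ^ 2 * Sη f)) + ∫⁻ f, ENNReal.ofReal (recoveredPower H SX Sη S f) ≤
      (∫⁻ f, ENNReal.ofReal (SX f)) + ENNReal.ofReal ε := by
  have : Fact (0 < w) := ⟨hw⟩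
  have hX' := hX.measurable
  have hSm := hS.measurable
  have het := measurable_expo t
  set q : ℝ → ℝ := fun f => ‖H f‖ ^ 2 * SX f + Sη f with hq
  have hq0 : ∀ f, 0 ≤ q f := fun f => by
    have := hX.nonneg f
    have := hSη_nonneg f
    positivity
  have hqm : Measurable q := by fun_prop
  set r : ℝ → ℂ := fun f => expo t f * (SX f * conj (H f) / (‖H f‖ ^ 2 * SX f + Sη f : ℝ)) with hr
  have hrm : Measurable r := by
    have : Measurable fun f => conj (H f) := continuous_conj.measurable.comp hH
    fun_prop
  have hrgain : ∀ f, q f * ‖r f‖ ^ 2 = gain (SX f) (snr H Sη f) := fun f => by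
    rw [hr, norm_mul, norm_expo, one_mul]
    exact mul_norm_wiener_sq (hX.nonneg f) (hSη_nonneg f) (hSη_zero f)
  choose β hβm hβ using fun k => hS.exists_section k
  have hdens : ∀ k, ∀ F : ℝ → ℝ, Measurable F → (∀ f, 0 ≤ F f) →
      ∫⁻ f, ENNReal.ofReal (F f) ∂(spectralMeasure fun f => ‖S k f‖ ^ 2 * q f) =
        ∫⁻ f, ENNReal.ofReal (F f * (‖S k f‖ ^ 2 * q f)) := fun k F hF hF0 =>
    lintegral_spectralMeasure (by fun_prop) hF hF0
  have hmk : Measurable fun f : ℝ => (f : AddCircle w) := AddCircle.measurable_mk'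
  have hd : ∀ k, ∃ d : ℤ →₀ ℂ, ∫⁻ f, ENNReal.ofReal
      (‖(∑ n ∈ d.support, d n * expo (n * T) f) - r (β k (f : AddCircle w))‖ ^ 2 *
        (‖S k f‖ ^ 2 * q f)) ≤ ENNReal.ofReal (ε / M) := by
    intro k
    have hfin : IsFiniteMeasure (spectralMeasure fun f => ‖S k f‖ ^ 2 * q f) :=
      isFiniteMeasure_withDensity (hbank.lintegral_branch_power hX hH hSη hSη_nonneg k).ne
    have hβm' := (hβm k).comp hmk
    have hrβ : Measurable fun f : ℝ => r (β k (f : AddCircle w)) := hrm.comp hβm'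
    have hfinite : ∫⁻ f, ENNReal.ofReal (‖r (β k (f : AddCircle w))‖ ^ 2)
        ∂(spectralMeasure fun f => ‖S k f‖ ^ 2 * q f) < ∞ := by
      rw [hdens k _ (by fun_prop) fun f => by positivity]
      refine lt_of_le_of_lt (lintegral_mono fun f => ENNReal.ofReal_le_ofReal ?_)
        hX.integrable.lintegral_lt_top
      -- On the pass band the integrand is the gain, which is at most the input density.
      rcases hS.eq_zero_or_one hw k f with h | h
      · simpa [h] using hX.nonneg f
      · rw [hβ k f (by simp [h]), h]
        have := gain_le (hX.nonneg f) (snr_nonneg (H := H) hSη_nonneg f)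
        rw [← hrgain] at this
        simpa [mul_comm] using this
    obtain ⟨d, hd⟩ := exists_trigonometric_approx hwT _ (r := r ∘ β k) (hrm.comp (hβm k)) hfinite
      (ε := ε / M) (by positivity)
    refine ⟨d, ?_⟩
    have hpm : Measurable fun f => ∑ n ∈ d.support, d n * expo (n * T) f :=
      Finset.measurable_sum _ fun n _ => (measurable_expo _).const_mul _
    rwa [hdens k _ (by simp only [Function.comp_apply]; fun_prop) fun f => by positivity] at hd
  choose d hd using hd
  obtain ⟨c, hc⟩ := exists_combination_eq T S d
  refine ⟨c, ?_⟩
  have hpt : ∀ᵐ f, ENNReal.ofReal (‖expo t f - H f * combination T S c f‖ ^ 2 * SX f +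
        ‖combination T S c f‖ ^ 2 * Sη f) + ENNReal.ofReal (recoveredPower H SX Sη S f) =
      ENNReal.ofReal (SX f) + ∑ k, ENNReal.ofReal
        (‖(∑ n ∈ (d k).support, d k n * expo (n * T) f) - r (β k (f : AddCircle w))‖ ^ 2 *
          (‖S k f‖ ^ 2 * q f)) := by
    filter_upwards [hS.ae_disjoint hw] with f hf
    have h1 := hX.nonneg f
    have h2 := hSη_nonneg f
    have h3 := hq0 f
    rw [← ENNReal.ofReal_add (by positivity) (recoveredPower_nonneg hSη_nonneg hX.nonneg f),
      ← ENNReal.ofReal_sum_of_nonneg fun k _ => by positivity,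
      ← ENNReal.ofReal_add h1 (Finset.sum_nonneg fun k _ => by positivity)]
    congr 1
    by_cases hk : ∃ k, S k f ≠ 0
    · obtain ⟨k, hk⟩ := hk
      have hk1 : S k f = 1 := (hS.eq_zero_or_one hw k f).resolve_left hk
      have hk0 : ∀ k', k' ≠ k → S k' f = 0 := fun k' hne => by
        by_contra h
        exact hne (hf k' k h hk)
      rw [hc, recoveredPower,
        Finset.sum_eq_single k (fun k' _ hne => by simp [hk0 k' hne]) (by simp),
        Finset.sum_eq_single k (fun k' _ hne => by simp [hk0 k' hne]) (by simp),
        Finset.sum_eq_single k (fun k' _ hne => by simp [hk0 k' hne]) (by simp), hβ k f hk, hk1,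
        norm_sub_sq_add_eq h1 h2 (hSη_zero f) (norm_expo t f)]
      simp only [hr, hq, snr, one_mul, norm_one, one_pow]
      ring
    · push Not at hk
      simp [hc, recoveredPower, hk, norm_expo]
  have hcm := measurable_combination T hSm c
  rw [← lintegral_add_right _ (measurable_recoveredPower hH hSη hX' hSm).ennreal_ofReal,
    lintegral_congr_ae hpt, lintegral_add_left (by fun_prop), lintegral_finsetSum]
  · gcongr
    refine (Finset.sum_le_sum fun k _ => hd k).trans (le_of_eq ?_)
    rw [Finset.sum_const, Finset.card_univ, Fintype.card_fin, nsmul_eq_mul,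
      ← ENNReal.ofReal_natCast, ← ENNReal.ofReal_mul (by positivity)]
    congr 1
    field_simp
  · intro k _
    have hrβ : Measurable fun f : ℝ => r (β k (f : AddCircle w)) := hrm.comp ((hβm k).comp hmk)
    have hpm : Measurable fun f => ∑ n ∈ (d k).support, d k n * expo (n * T) f :=
      Finset.measurable_sum _ fun n _ => (measurable_expo _).const_mul _
    fun_prop

end OptimalBank

/-! ### Bounds on the mean squared error -/

section Bounds

variable {Ω : Type*} [MeasurableSpace Ω] {P : Measure Ω} {M : ℕ} {w T : ℝ} {H : ℝ → ℂ}
  {SX SX' Sη : ℝ → ℝ} {ℓ : Fin M → ℝ → ℤ} {S S' : Fin M → ℝ → ℂ} {x : ℝ → Lp ℂ 2 P}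
  {η : 𝓢(ℝ, ℂ) → Lp ℂ 2 P} {y : Fin M → ℝ → Lp ℂ 2 P}

lemma IsOptimalBank.tsum_recoveredPower (hS : IsOptimalBank w H Sη ℓ S) (hSX : ∀ f, 0 ≤ SX f)
    (hSη : ∀ f, 0 ≤ Sη f) {f : ℝ} (hf : f ∈ baseBand w) :
    ∑' l : ℤ, ENNReal.ofReal (recoveredPower H SX Sη S (f - l * w)) =
      ENNReal.ofReal (∑ k, gain (SX (f - ℓ k f * w)) (snr H Sη (f - ℓ k f * w))) := by
  have hg : ∀ f, 0 ≤ gain (SX f) (snr H Sη f) := fun f => gain_nonneg (hSX f) (snr_nonneg hSη f)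
  unfold recoveredPower
  simp_rw [ENNReal.ofReal_sum_of_nonneg fun k _ => mul_nonneg (sq_nonneg ‖S k _‖) (hg _)]
  rw [ENNReal.ofReal_sum_of_nonneg fun k _ => hg _,
    Summable.tsum_finsetSum fun _ _ => ENNReal.summable]
  refine Finset.sum_congr rfl fun k _ => ?_
  rw [tsum_eq_single (ℓ k f) fun l hl => by simp [hS.response k f hf l, hl]]
  simp [hS.response k f hf]

lemma IsOptimalBank.isFilterBank (hS : IsOptimalBank w H Sη ℓ S) (hw : 0 < w) (hX : IsPSD SX)
    (hHb : ∃ C : ℝ, ∀ f, ‖H f‖ ≤ C) (hH : Measurable H) (hSη : Measurable Sη)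
    (hSη_nonneg : ∀ f, 0 ≤ Sη f) (hnoise : Integrable Sη ∨ ∃ N₀ : ℝ, ∀ f, Sη f = N₀) :
    IsFilterBank H SX Sη S := by
  have hSm := hS.measurable
  have hX' := hX.measurable
  have hS1 : ∀ k f, ‖S k f‖ ^ 2 ≤ 1 := fun k f =>
    pow_le_one₀ (norm_nonneg _) (hS.norm_le_one hw k f)
  refine ⟨hSm, fun k => ?_, fun k => ?_⟩
  · obtain ⟨C, hC⟩ := hHb
    rw [lintegral_spectralMeasure hX' (by fun_prop) fun f => by positivity]
    refine lt_of_le_of_lt (lintegral_mono fun f => ENNReal.ofReal_le_ofReal ?_)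
      (hX.integrable.const_mul (C ^ 2)).lintegral_lt_top
    have h2 : ‖H f‖ ^ 2 ≤ C ^ 2 := pow_le_pow_left₀ (norm_nonneg _) (hC f) 2
    rw [norm_mul, mul_pow]
    refine mul_le_mul_of_nonneg_right ?_ (hX.nonneg f)
    nlinarith [hS1 k f, sq_nonneg ‖H f‖]
  · rw [lintegral_spectralMeasure hSη (by fun_prop) fun f => by positivity]
    rcases hnoise with hi | ⟨N₀, hN⟩
    · refine lt_of_le_of_lt (lintegral_mono fun f => ENNReal.ofReal_le_ofReal ?_)
        hi.lintegral_lt_top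
      nlinarith [hS1 k f, hSη_nonneg f]
    -- White noise has infinite power, but each filter passes one frequency per aliased set, so its
    -- pass band has total length `w`.
    · simp_rw [hN, ENNReal.ofReal_mul (sq_nonneg ‖S k _‖)]
      rw [lintegral_mul_const _ (by fun_prop), lintegral_eq_lintegral_tsum hw (by fun_prop)]
      refine ENNReal.mul_lt_top ?_ ENNReal.ofReal_lt_top
      rw [setLIntegral_congr_fun (g := fun _ => 1) (measurableSet_baseBand w)]
      · simp [baseBand]
      · intro f hf
        dsimp only
        rw [tsum_eq_single (ℓ k f) fun l hl => by simp [hS.response k f hf l, hl]]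
        simp [hS.response k f hf]

lemma IsAliasRearrangement.lintegral_eq (h : IsAliasRearrangement w SX SX') (hw : 0 < w)
    (hX : IsPSD SX) (hX' : IsPSD SX') :
    ∫⁻ f, ENNReal.ofReal (SX' f) = ∫⁻ f, ENNReal.ofReal (SX f) := by
  rw [lintegral_eq_lintegral_tsum hw hX.measurable.ennreal_ofReal,
    lintegral_eq_lintegral_tsum hw hX'.measurable.ennreal_ofReal]
  refine lintegral_congr_ae ?_
  filter_upwards [h] with f ⟨σ, hσ⟩
  simp_rw [hσ]
  exact σ.tsum_eq fun l : ℤ => ENNReal.ofReal (SX (f - l * w))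

lemma sum_mul_gain_alias_le {f : ℝ} (hSX : ∀ f, 0 ≤ SX f) (hSη : ∀ f, 0 ≤ Sη f)
    {m : Fin M → ℤ} (hs : IsTopSelection w SX f m) (hγ : IsTopSelection w (snr H Sη) f m)
    {σ : Equiv.Perm ℤ} (hσ : ∀ l : ℤ, SX' (f - l * w) = SX (f - σ l * w)) {F : Finset ℤ}
    {ω : ℤ → ℝ} (hω0 : ∀ l, 0 ≤ ω l) (hω1 : ∀ l, ω l ≤ 1) (hsum : ∑ l ∈ F, ω l ≤ M) :
    ∑ l ∈ F, ω l * gain (SX' (f - l * w)) (snr H Sη (f - l * w)) ≤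
      ∑ k, gain (SX (f - m k * w)) (snr H Sη (f - m k * w)) := by
  simp_rw [hσ]
  exact sum_mul_gain_le (s := fun l => SX (f - l * w)) (γ := fun l => snr H Sη (f - l * w))
    hs.injective (fun _ => hSX _) (fun _ => snr_nonneg hSη _) hs.antitone hγ.antitone hs.dominates
    hγ.dominates σ hω0 hω1 hsum

/-- The mean squared error that the optimal bank attains. -/
theorem linearMSE_add_recoveredPower_le (h : IsFilterBankOutput P H SX Sη S x η y) (hM : 0 < M)
    (hw : 0 < w) (hwT : w * T = 1) (hS : IsOptimalBank w H Sη ℓ S) (hH : Measurable H)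
    (hSη : Measurable Sη) (hSη_nonneg : ∀ f, 0 ≤ Sη f) (hSη_zero : ∀ f, Sη f = 0 → H f = 0)
    (hnoise : Integrable Sη ∨ ∃ N₀ : ℝ, ∀ f, Sη f = N₀) (t : ℝ) :
    ENNReal.ofReal (linearMSE P T x y t) + ∫⁻ f, ENNReal.ofReal (recoveredPower H SX Sη S f) ≤
      ∫⁻ f, ENNReal.ofReal (SX f) := by
  refine ENNReal.le_of_forall_pos_le_add fun ε hε _ => ?_
  obtain ⟨c, hc⟩ := exists_combination_lintegral_le hM hw hwT hS h.input.psd h.bank hH hSη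
    hSη_nonneg hSη_zero t (ε := ε) hε
  rw [← h.ofReal_norm_sub_sq hH hSη hSη_nonneg hnoise] at hc
  rw [ENNReal.ofReal_coe_nnreal] at hc
  refine le_trans ?_ hc
  gcongr
  exact linearMSE_le T t c

lemma ofReal_add_le_of_forall {a : ℝ} {A B : ℝ≥0∞}
    (h : ∀ ε : ℝ, 0 < ε → B ≤ ENNReal.ofReal (a + ε) + A) (ha : 0 ≤ a) :
    B ≤ ENNReal.ofReal a + A := by
  refine ENNReal.le_of_forall_pos_le_add fun ε hε _ => ?_
  refine (h ε hε).trans (le_of_eq ?_)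
  rw [ENNReal.ofReal_add (q := (ε : ℝ)) ha ε.2, ENNReal.ofReal_coe_nnreal]
  ring

/-- The noncausal Wiener lower bound on the mean squared error of any bank. -/
lemma le_linearMSE_add_gain (h : IsFilterBankOutput P H SX Sη S x η y) (hH : Measurable H)
    (hSη : Measurable Sη) (hSη_nonneg : ∀ f, 0 ≤ Sη f) (hSη_zero : ∀ f, Sη f = 0 → H f = 0)
    (hnoise : Integrable Sη ∨ ∃ N₀ : ℝ, ∀ f, Sη f = N₀) (t : ℝ) :
    ∫⁻ f, ENNReal.ofReal (SX f) ≤ ENNReal.ofReal (linearMSE P T x y t) +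
      ∫⁻ f, ENNReal.ofReal (gain (SX f) (snr H Sη f)) := by
  refine ofReal_add_le_of_forall (fun ε hε => ?_) (linearMSE_nonneg T t)
  obtain ⟨c, hc⟩ := exists_norm_sub_sq_le_linearMSE (P := P) (x := x) (y := y) T t hε
  refine le_trans ?_ (add_le_add_left (ENNReal.ofReal_le_ofReal hc) _)
  have hX := h.input.psd
  rw [h.ofReal_norm_sub_sq hH hSη hSη_nonneg hnoise,
    ← lintegral_add_right _ (measurable_gain hH hSη hX.measurable).ennreal_ofReal]
  refine lintegral_mono fun f => ?_
  have h1 := hX.nonneg f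
  have h2 := hSη_nonneg f
  have h3 := gain_nonneg h1 (snr_nonneg (H := H) hSη_nonneg f)
  rw [← ENNReal.ofReal_add (by positivity) h3]
  refine ENNReal.ofReal_le_ofReal ?_
  rw [norm_sub_sq_add_eq h1 h2 (hSη_zero f) (norm_expo t f), snr]
  have : 0 ≤ ‖H f‖ ^ 2 * SX f + Sη f := by positivity
  have := mul_nonneg this (sq_nonneg ‖combination T S c f - expo t f *
    (SX f * conj (H f) / (‖H f‖ ^ 2 * SX f + Sη f : ℝ))‖)
  linarith

/-- The density vanishes off the selected frequencies, so a rearrangement has at most `M` nonzero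
values per aliased set. The full sum of gains is then a weighted sum with indicator weights, and
rearrangement applies without averaging over time. -/
lemma lintegral_gain_le_recoveredPower (hw : 0 < w) (hS : IsOptimalBank w H Sη ℓ S)
    (hX : IsPSD SX) (hX' : IsPSD SX') (hH : Measurable H) (hSη : Measurable Sη)
    (hSη_nonneg : ∀ f, 0 ≤ Sη f) (hmatch : IsMatched w ℓ SX)
    (hsupp : ∀ f ∈ baseBand w, ∀ l : ℤ, l ∉ Set.range (fun k => ℓ k f) → SX (f - l * w) = 0)
    (hre : IsAliasRearrangement w SX SX') :
    ∫⁻ f, ENNReal.ofReal (gain (SX' f) (snr H Sη f)) ≤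
      ∫⁻ f, ENNReal.ofReal (recoveredPower H SX Sη S f) := by
  classical
  rw [lintegral_eq_lintegral_tsum hw (measurable_gain hH hSη hX'.measurable).ennreal_ofReal,
    lintegral_eq_lintegral_tsum hw
      (measurable_recoveredPower hH hSη hX.measurable hS.measurable).ennreal_ofReal]
  refine lintegral_mono_ae ?_
  filter_upwards [hmatch, hre, hS.selection, ae_restrict_mem (measurableSet_baseBand w)]
    with f hs ⟨σ, hσ⟩ hγ hf
  rw [hS.tsum_recoveredPower hX.nonneg hSη_nonneg hf, ENNReal.tsum_eq_iSup_sum]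
  refine iSup_le fun F => ?_
  rw [← ENNReal.ofReal_sum_of_nonneg fun l _ =>
    gain_nonneg (hX'.nonneg _) (snr_nonneg hSη_nonneg _)]
  refine ENNReal.ofReal_le_ofReal ?_
  have hcard : (F.filter fun l => σ l ∈ Set.range fun k => ℓ k f).card ≤ M := by
    rw [← Finset.card_image_of_injective _ σ.injective]
    refine (Finset.card_le_card (t := Finset.univ.image fun k => ℓ k f) fun l hl => ?_).trans
      (Finset.card_image_le.trans (by simp))
    obtain ⟨l, hlF, rfl⟩ := Finset.mem_image.1 hl
    obtain ⟨k, hk⟩ := (Finset.mem_filter.1 hlF).2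
    exact Finset.mem_image.2 ⟨k, Finset.mem_univ _, hk⟩
  refine le_trans (le_of_eq (Finset.sum_congr rfl fun l _ => ?_))
    (sum_mul_gain_alias_le hX.nonneg hSη_nonneg hs hγ hσ (F := F)
      (ω := fun l => if σ l ∈ Set.range fun k => ℓ k f then 1 else 0)
      (fun l => by split_ifs <;> simp) (fun l => by split_ifs <;> simp)
      (by simpa [Finset.sum_ite] using hcard))
  split_ifs with h
  · rw [one_mul]
  · rw [hσ, hsupp f hf _ h]
    simp [gain]

/-! ### The error averaged over a sampling period -/

/-- Cutting the period into `N` equal pieces and translating them onto the first turns the integral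
into one of the sum over equally spaced instants. -/
lemma mul_le_integral_of_le_sum {g : ℝ → ℝ} (hg : Continuous g) (hT : 0 ≤ T) {N : ℕ} (hN : 0 < N)
    {κ : ℝ} (h : ∀ τ, N * κ ≤ ∑ j ∈ Finset.range N, g (τ + j * (T / N))) :
    T * κ ≤ ∫ t in (0 : ℝ)..T, g t := by
  have hN' : (N : ℝ) ≠ 0 := by exact_mod_cast hN.ne'
  have h1 := intervalIntegral.sum_integral_adjacent_intervals (μ := volume) (f := g) (n := N)
    (a := fun j => j * (T / N)) fun j _ => hg.intervalIntegrable _ _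
  have h2 : ∀ j : ℕ, ∫ t in (j * (T / N))..((j + 1 : ℕ) * (T / N)), g t =
      ∫ τ in (0 : ℝ)..(T / N), g (τ + j * (T / N)) := fun j => by
    rw [intervalIntegral.integral_comp_add_right, zero_add]
    congr 1
    push_cast
    ring
  simp_rw [h2] at h1
  rw [← intervalIntegral.integral_finsetSum fun j _ =>
    Continuous.intervalIntegrable (by fun_prop) _ _] at h1
  have e1 : (N : ℝ) * (T / N) = T := by field_simp
  rw [e1, Nat.cast_zero, zero_mul] at h1
  rw [← h1]
  have h3 : ∫ _ in (0 : ℝ)..(T / N), N * κ ≤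
      ∫ τ in (0 : ℝ)..(T / N), ∑ j ∈ Finset.range N, g (τ + j * (T / N)) :=
    intervalIntegral.integral_mono_on (by positivity) intervalIntegrable_const
      (Continuous.intervalIntegrable (by fun_prop) _ _) fun τ _ => h τ
  refine le_trans (le_of_eq ?_) h3
  rw [intervalIntegral.integral_const, smul_eq_mul]
  field_simp
  ring

/-- The mean squared errors at equally spaced instants of a period, for an arbitrary bank. -/
lemma le_sum_linearMSE (h : IsFilterBankOutput P H SX' Sη S' x η y) (hw : 0 < w) (hwT : w * T = 1)
    (hS : IsOptimalBank w H Sη ℓ S) (hX : IsPSD SX) (hH : Measurable H) (hSη : Measurable Sη)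
    (hSη_nonneg : ∀ f, 0 ≤ Sη f) (hSη_zero : ∀ f, Sη f = 0 → H f = 0)
    (hnoise : Integrable Sη ∨ ∃ N₀ : ℝ, ∀ f, Sη f = N₀) (hmatch : IsMatched w ℓ SX)
    (hre : IsAliasRearrangement w SX SX') (L : ℕ) (τ : ℝ) :
    (2 * L + 1 : ℕ) * ∫⁻ f in baseBand w, ∑ l ∈ Finset.Icc (-L : ℤ) L,
        ENNReal.ofReal (SX' (f - l * w)) ≤
      ENNReal.ofReal (∑ j ∈ Finset.range (2 * L + 1),
        linearMSE P T x y (τ + j * (T / (2 * L + 1 : ℕ)))) +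
      (2 * L + 1 : ℕ) * ∫⁻ f, ENNReal.ofReal (recoveredPower H SX Sη S f) := by
  have hX' := h.input.psd
  have hX'm := hX'.measurable
  refine ofReal_add_le_of_forall (fun ε hε => ?_) (Finset.sum_nonneg fun j _ =>
    linearMSE_nonneg T _)
  choose c hc using fun j : ℕ => exists_norm_sub_sq_le_linearMSE (P := P) (x := x) (y := y) T
    (τ + j * (T / (2 * L + 1 : ℕ))) (ε := ε / (2 * L + 1 : ℕ)) (by positivity)
  set G : ℕ → ℝ → ℝ := fun j f => ‖expo (τ + j * (T / (2 * L + 1 : ℕ))) f -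
    H f * combination T S' (c j) f‖ ^ 2 * SX' f + ‖combination T S' (c j) f‖ ^ 2 * Sη f with hG
  have hGm : ∀ j, Measurable (G j) := fun j => by
    have h1 := measurable_combination T h.bank.measurable (c j)
    have h2 := measurable_expo (τ + j * (T / (2 * L + 1 : ℕ)))
    fun_prop
  have hG0 : ∀ j f, 0 ≤ G j f := fun j f => by
    have := hX'.nonneg f
    have := hSη_nonneg f
    positivity
  have hRm := measurable_recoveredPower hH hSη hX.measurable hS.measurable
  -- Dropping the frequencies outside the window only decreases the error.
  have hstep : ∀ j, ∫⁻ f in baseBand w, ∑ l ∈ Finset.Icc (-L : ℤ) L,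
      ENNReal.ofReal (G j (f - l * w)) ≤ ENNReal.ofReal
        (linearMSE P T x y (τ + j * (T / (2 * L + 1 : ℕ))) + ε / (2 * L + 1 : ℕ)) := fun j => by
    refine le_trans ?_ (ENNReal.ofReal_le_ofReal (hc j))
    rw [h.ofReal_norm_sub_sq hH hSη hSη_nonneg hnoise,
      lintegral_eq_lintegral_tsum hw (hGm j).ennreal_ofReal]
    exact lintegral_mono fun f => ENNReal.sum_le_tsum _
  have hpt : ∀ᵐ f ∂(volume.restrict (baseBand w)),
      (2 * L + 1 : ℕ) * ∑ l ∈ Finset.Icc (-L : ℤ) L, ENNReal.ofReal (SX' (f - l * w)) ≤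
        (∑ j ∈ Finset.range (2 * L + 1), ∑ l ∈ Finset.Icc (-L : ℤ) L,
          ENNReal.ofReal (G j (f - l * w))) +
        (2 * L + 1 : ℕ) * ∑' l : ℤ, ENNReal.ofReal (recoveredPower H SX Sη S (f - l * w)) := by
    filter_upwards [hmatch, hre, hS.selection, ae_restrict_mem (measurableSet_baseBand w)]
      with f hs ⟨σ, hσ⟩ hγ hf
    obtain ⟨ω, h0, h1, h2, h3⟩ :=
      exists_weights_alias hwT hX'.nonneg hSη_nonneg hSη_zero S' L τ c f
    have h4 := sum_mul_gain_alias_le hX.nonneg hSη_nonneg hs hγ hσ h0 h1 h2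
    rw [hS.tsum_recoveredPower hX.nonneg hSη_nonneg hf,
      ← ENNReal.ofReal_sum_of_nonneg fun l _ => hX'.nonneg _]
    simp_rw [← ENNReal.ofReal_sum_of_nonneg fun l _ => hG0 _ _]
    rw [← ENNReal.ofReal_sum_of_nonneg fun j _ => Finset.sum_nonneg fun l _ => hG0 _ _,
      ← ENNReal.ofReal_natCast, ← ENNReal.ofReal_mul (Nat.cast_nonneg _),
      ← ENNReal.ofReal_mul (Nat.cast_nonneg _), ← ENNReal.ofReal_add
        (Finset.sum_nonneg fun j _ => Finset.sum_nonneg fun l _ => hG0 _ _)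
        (mul_nonneg (Nat.cast_nonneg _) (Finset.sum_nonneg fun k _ =>
          gain_nonneg (hX.nonneg _) (snr_nonneg hSη_nonneg _)))]
    refine ENNReal.ofReal_le_ofReal ?_
    rw [Finset.sum_sub_distrib, mul_sub, sub_le_iff_le_add] at h3
    refine h3.trans (add_le_add_right ?_ _)
    exact mul_le_mul_of_nonneg_left h4 (Nat.cast_nonneg _)
  calc (2 * L + 1 : ℕ) * ∫⁻ f in baseBand w, ∑ l ∈ Finset.Icc (-L : ℤ) L,
        ENNReal.ofReal (SX' (f - l * w))
      = ∫⁻ f in baseBand w, (2 * L + 1 : ℕ) * ∑ l ∈ Finset.Icc (-L : ℤ) L,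
        ENNReal.ofReal (SX' (f - l * w)) := by
        rw [lintegral_const_mul _ (by fun_prop)]
    _ ≤ _ := lintegral_mono_ae hpt
    _ = (∑ j ∈ Finset.range (2 * L + 1), ∫⁻ f in baseBand w, ∑ l ∈ Finset.Icc (-L : ℤ) L,
          ENNReal.ofReal (G j (f - l * w))) +
        (2 * L + 1 : ℕ) * ∫⁻ f, ENNReal.ofReal (recoveredPower H SX Sη S f) := by
        rw [lintegral_add_left (by fun_prop), lintegral_finsetSum _ fun j _ => by fun_prop,
          lintegral_const_mul _ (by fun_prop),
          ← lintegral_eq_lintegral_tsum hw hRm.ennreal_ofReal]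
    _ ≤ _ := by
        gcongr
        refine (Finset.sum_le_sum fun j _ => hstep j).trans (le_of_eq ?_)
        rw [← ENNReal.ofReal_sum_of_nonneg fun j _ =>
          add_nonneg (linearMSE_nonneg T _) (by positivity), Finset.sum_add_distrib,
          Finset.sum_const, Finset.card_range, nsmul_eq_mul]
        congr 2
        field_simp

lemma lintegral_eq_iSup_lintegral_sum (hw : 0 < w) {F : ℝ → ℝ≥0∞} (hF : Measurable F) :
    ∫⁻ f, F f = ⨆ L : ℕ, ∫⁻ f in baseBand w, ∑ l ∈ Finset.Icc (-L : ℤ) L, F (f - l * w) := by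
  rw [lintegral_eq_lintegral_tsum hw hF, ← lintegral_iSup (fun L => by fun_prop)]
  · refine lintegral_congr fun f => ?_
    refine ENNReal.tsum_eq_iSup_sum' (fun L : ℕ => Finset.Icc (-L : ℤ) L) fun t => ?_
    refine ⟨t.sup Int.natAbs, fun l hl => ?_⟩
    have := Finset.le_sup (f := Int.natAbs) hl
    rw [Finset.mem_Icc]
    omega
  · intro L L' hL f
    refine Finset.sum_le_sum_of_subset (Finset.Icc_subset_Icc ?_ ?_) <;> simpa using hL

/-- The averaged mean squared error of an arbitrary bank. -/
theorem le_average_linearMSE_add_recoveredPower (h : IsFilterBankOutput P H SX' Sη S' x η y)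
    (hw : 0 < w) (hwT : w * T = 1)
    (hS : IsOptimalBank w H Sη ℓ S) (hX : IsPSD SX) (hH : Measurable H) (hSη : Measurable Sη)
    (hSη_nonneg : ∀ f, 0 ≤ Sη f) (hSη_zero : ∀ f, Sη f = 0 → H f = 0)
    (hnoise : Integrable Sη ∨ ∃ N₀ : ℝ, ∀ f, Sη f = N₀) (hmatch : IsMatched w ℓ SX)
    (hre : IsAliasRearrangement w SX SX')
    (hfin : ∫⁻ f, ENNReal.ofReal (recoveredPower H SX Sη S f) < ∞) :
    ∫⁻ f, ENNReal.ofReal (SX' f) ≤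
      ENNReal.ofReal (w * ∫ t in (0 : ℝ)..T, linearMSE P T x y t) +
      ∫⁻ f, ENNReal.ofReal (recoveredPower H SX Sη S f) := by
  have hX' := h.input.psd
  have hT : 0 ≤ T := by
    by_contra! hT
    nlinarith
  rw [lintegral_eq_iSup_lintegral_sum hw hX'.measurable.ennreal_ofReal]
  refine iSup_le fun L => ?_
  set B := ∫⁻ f in baseBand w, ∑ l ∈ Finset.Icc (-L : ℤ) L,
    ENNReal.ofReal (SX' (f - l * w)) with hB
  set A := ∫⁻ f, ENNReal.ofReal (recoveredPower H SX Sη S f) with hA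
  have hBfin : B ≠ ∞ := by
    refine (lt_of_le_of_lt ?_ hX'.integrable.lintegral_lt_top).ne
    rw [lintegral_eq_iSup_lintegral_sum hw hX'.measurable.ennreal_ofReal]
    exact le_iSup (fun L : ℕ => ∫⁻ f in baseBand w, ∑ l ∈ Finset.Icc (-L : ℤ) L,
      ENNReal.ofReal (SX' (f - l * w))) L
  -- Both integrals are finite, so the bound can be rewritten with real subtraction before
  -- integrating over `τ`.
  have hsum : ∀ τ, (2 * L + 1 : ℕ) * (B.toReal - A.toReal) ≤
      ∑ j ∈ Finset.range (2 * L + 1), linearMSE P T x y (τ + j * (T / (2 * L + 1 : ℕ))) :=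
    fun τ => by
    have h0 := le_sum_linearMSE h hw hwT hS hX hH hSη hSη_nonneg hSη_zero hnoise hmatch hre L τ
    rw [← hB, ← hA, ← ENNReal.ofReal_toReal hBfin, ← ENNReal.ofReal_toReal hfin.ne,
      ← ENNReal.ofReal_natCast, ← ENNReal.ofReal_mul (Nat.cast_nonneg _),
      ← ENNReal.ofReal_mul (Nat.cast_nonneg _), ← ENNReal.ofReal_add
        (Finset.sum_nonneg fun j _ => linearMSE_nonneg T _) (by positivity),
      ENNReal.ofReal_le_ofReal_iff (add_nonneg (Finset.sum_nonneg fun j _ => linearMSE_nonneg T _)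
        (by positivity))] at h0
    linarith
  have hint := mul_le_integral_of_le_sum (continuous_linearMSE h.input T) hT
    (Nat.succ_pos (2 * L)) hsum
  have hnn : 0 ≤ w * ∫ t in (0 : ℝ)..T, linearMSE P T x y t :=
    mul_nonneg hw.le (intervalIntegral.integral_nonneg hT fun t _ => linearMSE_nonneg T t)
  rw [← ENNReal.ofReal_toReal hBfin, ← ENNReal.ofReal_toReal hfin.ne,
    ← ENNReal.ofReal_add hnn ENNReal.toReal_nonneg]
  refine ENNReal.ofReal_le_ofReal ?_
  have := mul_le_mul_of_nonneg_left hint hw.le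
  rw [← mul_assoc, hwT, one_mul] at this
  linarith

/-! ### Water filling -/

lemma waterFilling_nonneg (ν f : ℝ) : 0 ≤ waterFilling H Sη S ν f := by
  unfold waterFilling
  split_ifs
  exacts [le_max_right _ _, le_rfl]

lemma measurable_waterFilling (hH : Measurable H) (hSη : Measurable Sη)
    (hS : ∀ k, Measurable (S k)) (ν : ℝ) : Measurable (waterFilling H Sη S ν) := by
  have hsnr := measurable_snr hH hSη
  unfold waterFilling
  refine Measurable.ite ?_ (by fun_prop) measurable_const
  have : {f | (∃ k, S k f ≠ 0) ∧ snr H Sη f ≠ 0} =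
      (⋃ k, S k ⁻¹' {0}ᶜ) ∩ snr H Sη ⁻¹' {0}ᶜ := by
    ext f; simp
  rw [this]
  exact (MeasurableSet.iUnion fun k => hS k (measurableSet_singleton 0).compl).inter
    (hsnr (measurableSet_singleton 0).compl)

lemma IsOptimalBank.waterFilling_eq_zero (hS : IsOptimalBank w H Sη ℓ S) (ν : ℝ) {f : ℝ}
    (hf : f ∈ baseBand w) {l : ℤ} (hl : l ∉ Set.range fun k => ℓ k f) :
    waterFilling H Sη S ν (f - l * w) = 0 := by
  rw [waterFilling, if_neg]
  rintro ⟨⟨k, hk⟩, -⟩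
  rw [hS.response k f hf] at hk
  exact hl ⟨k, by simpa [eq_comm] using hk⟩

/-- The level `ν - 1/γ` increases with `γ`; only the frequency of larger ratio has to be passed,
since the density is `0` at a frequency that is not. -/
lemma waterFilling_mono (hSη : ∀ f, 0 ≤ Sη f) (ν : ℝ) {f g : ℝ} (hg : ∃ k, S k g ≠ 0)
    (h : snr H Sη f ≤ snr H Sη g) : waterFilling H Sη S ν f ≤ waterFilling H Sη S ν g := by
  by_cases hf : (∃ k, S k f ≠ 0) ∧ snr H Sη f ≠ 0
  · have h0 : 0 < snr H Sη f := lt_of_le_of_ne (snr_nonneg hSη f) (Ne.symm hf.2)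
    rw [waterFilling, waterFilling, if_pos hf, if_pos ⟨hg, (h0.trans_le h).ne'⟩]
    gcongr
  · have : waterFilling H Sη S ν f = 0 := by rw [waterFilling, if_neg hf]
    rw [this]
    exact waterFilling_nonneg ν g

lemma IsOptimalBank.isMatched_waterFilling (hS : IsOptimalBank w H Sη ℓ S)
    (hSη : ∀ f, 0 ≤ Sη f) (ν : ℝ) : IsMatched w ℓ (waterFilling H Sη S ν) := by
  rw [IsMatched]
  filter_upwards [hS.selection, ae_restrict_mem (measurableSet_baseBand w)] with f hf hmem
  refine ⟨hf.injective, fun k k' hk => ?_, fun l hl k => ?_⟩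
  · exact waterFilling_mono hSη ν ⟨k, by simp [hS.response k f hmem]⟩ (hf.antitone hk)
  · rw [hS.waterFilling_eq_zero ν hmem hl]
    exact waterFilling_nonneg ν _

end Bounds

/-- Finiteness is what allows the recovered power to be cancelled in `ℝ≥0∞`; the crude bound `M *
SX` is enough. -/
lemma lintegral_recoveredPower_lt_top {M : ℕ} {w : ℝ} {H : ℝ → ℂ} {SX Sη : ℝ → ℝ}
    {ℓ : Fin M → ℝ → ℤ} {S : Fin M → ℝ → ℂ} (hw : 0 < w) (hS : IsOptimalBank w H Sη ℓ S)
    (hX : IsPSD SX) (hSη_nonneg : ∀ f, 0 ≤ Sη f) :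
    ∫⁻ f, ENNReal.ofReal (recoveredPower H SX Sη S f) < ∞ := by
  refine lt_of_le_of_lt (lintegral_mono fun f => ENNReal.ofReal_le_ofReal ?_)
    (hX.integrable.const_mul (M : ℝ)).lintegral_lt_top
  refine (Finset.sum_le_card_nsmul _ _ (SX f) fun k _ => ?_).trans (by simp)
  have h1 : ‖S k f‖ ^ 2 ≤ 1 := pow_le_one₀ (norm_nonneg _) (hS.norm_le_one hw k f)
  have h2 := gain_le (hX.nonneg f) (snr_nonneg (H := H) hSη_nonneg f)
  have h3 := gain_nonneg (hX.nonneg f) (snr_nonneg (H := H) hSη_nonneg f)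
  nlinarith

end SampledChannel

theorem proposition3
    {Ω Ω' : Type*} [MeasurableSpace Ω] [MeasurableSpace Ω']
    (P : MeasureTheory.Measure Ω) [MeasureTheory.IsProbabilityMeasure P]
    (P' : MeasureTheory.Measure Ω') [MeasureTheory.IsProbabilityMeasure P']
    (M : ℕ) (hM : 0 < M) (fs : ℝ) (hfs : 0 < fs)
    (H : ℝ → ℂ) (hH : Measurable H) (hHb : ∃ C : ℝ, ∀ f, ‖H f‖ ≤ C)
    (Sη : ℝ → ℝ) (hSη : Measurable Sη) (hSη_nonneg : ∀ f, 0 ≤ Sη f)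
    (hSη_zero : ∀ f, Sη f = 0 → H f = 0)
    (hnoise : MeasureTheory.Integrable Sη ∨ ∃ N₀ : ℝ, ∀ f, Sη f = N₀)
    (ℓ : Fin M → ℝ → ℤ) (S : Fin M → ℝ → ℂ)
    (hS : SampledChannel.IsOptimalBank (fs / M) H Sη ℓ S) :
    -- the capacity-optimal input of power `Pw`, and every time instant
    (∀ (Pw ν : ℝ) (SX : ℝ → ℝ), 0 < Pw →
      (∀ f, SX f = SampledChannel.waterFilling H Sη S ν f) → ∫ f, SX f = Pw →
      SampledChannel.IsPSD SX ∧ SampledChannel.IsFilterBank H SX Sη S ∧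
      ∀ (x : ℝ → MeasureTheory.Lp ℂ 2 P) (η : SchwartzMap ℝ ℂ → MeasureTheory.Lp ℂ 2 P)
        (y : Fin M → ℝ → MeasureTheory.Lp ℂ 2 P)
        (SX' : ℝ → ℝ) (S' : Fin M → ℝ → ℂ)
        (x' : ℝ → MeasureTheory.Lp ℂ 2 P') (η' : SchwartzMap ℝ ℂ → MeasureTheory.Lp ℂ 2 P')
        (y' : Fin M → ℝ → MeasureTheory.Lp ℂ 2 P'),
        SampledChannel.IsFilterBankOutput P H SX Sη S x η y →
        SampledChannel.IsAliasRearrangement (fs / M) SX SX' →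
        SampledChannel.IsFilterBankOutput P' H SX' Sη S' x' η' y' →
        ∀ t : ℝ, SampledChannel.linearMSE P (M / fs) x y t ≤
          SampledChannel.linearMSE P' (M / fs) x' y' t) ∧
    -- an arbitrary input density, optimally arranged, and the error averaged over a sampling period
    (∀ SX : ℝ → ℝ, SampledChannel.IsPSD SX → SampledChannel.IsMatched (fs / M) ℓ SX →
      SampledChannel.IsFilterBank H SX Sη S ∧
      ∀ (x : ℝ → MeasureTheory.Lp ℂ 2 P) (η : SchwartzMap ℝ ℂ → MeasureTheory.Lp ℂ 2 P)
        (y : Fin M → ℝ → MeasureTheory.Lp ℂ 2 P)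
        (SX' : ℝ → ℝ) (S' : Fin M → ℝ → ℂ)
        (x' : ℝ → MeasureTheory.Lp ℂ 2 P') (η' : SchwartzMap ℝ ℂ → MeasureTheory.Lp ℂ 2 P')
        (y' : Fin M → ℝ → MeasureTheory.Lp ℂ 2 P'),
        SampledChannel.IsFilterBankOutput P H SX Sη S x η y →
        SampledChannel.IsAliasRearrangement (fs / M) SX SX' →
        SampledChannel.IsFilterBankOutput P' H SX' Sη S' x' η' y' →
        (fs / M) * ∫ t in (0 : ℝ)..(M / fs), SampledChannel.linearMSE P (M / fs) x y t ≤
          (fs / M) * ∫ t in (0 : ℝ)..(M / fs), SampledChannel.linearMSE P' (M / fs) x' y' t) := by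
  have hMr : (0 : ℝ) < M := by exact_mod_cast hM
  have hw : 0 < fs / M := by positivity
  have hwT : fs / M * (M / fs) = 1 := by field_simp
  refine ⟨fun Pw ν SX hPw hSX hint => ?_, fun SX hX hmatch => ?_⟩
  · obtain rfl : SX = SampledChannel.waterFilling H Sη S ν := funext hSX
    have hX : SampledChannel.IsPSD (SampledChannel.waterFilling H Sη S ν) :=
      ⟨SampledChannel.measurable_waterFilling hH hSη hS.measurable ν,
        SampledChannel.waterFilling_nonneg ν, by
          -- A density that is not integrable would have Bochner integral `0`, contrary to the
          -- positive power.
          by_contra h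
          rw [MeasureTheory.integral_undef h] at hint
          exact hPw.ne hint⟩
    refine ⟨hX, hS.isFilterBank hw hX hHb hH hSη hSη_nonneg hnoise, ?_⟩
    intro x η y SX' S' x' η' y' hout hre hout' t
    have hX' := hout'.input.psd
    have h1 := SampledChannel.linearMSE_add_recoveredPower_le hout hM hw hwT hS hH hSη hSη_nonneg
      hSη_zero hnoise t
    rw [← hre.lintegral_eq hw hX hX'] at h1
    have h2 := (SampledChannel.le_linearMSE_add_gain (T := M / fs) hout' hH hSη hSη_nonneg hSη_zero
      hnoise t).trans (add_le_add_right (SampledChannel.lintegral_gain_le_recoveredPower hw hS hX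
        hX' hH hSη hSη_nonneg (hS.isMatched_waterFilling hSη_nonneg ν)
        (fun f hf l hl => hS.waterFilling_eq_zero ν hf hl) hre) _)
    have h3 := (ENNReal.add_le_add_iff_right (SampledChannel.lintegral_recoveredPower_lt_top hw hS
      hX hSη_nonneg).ne).1 (h1.trans h2)
    exact (ENNReal.ofReal_le_ofReal_iff (SampledChannel.linearMSE_nonneg _ _)).1 h3
  · refine ⟨hS.isFilterBank hw hX hHb hH hSη hSη_nonneg hnoise, ?_⟩
    intro x η y SX' S' x' η' y' hout hre hout'
    have hfin := SampledChannel.lintegral_recoveredPower_lt_top hw hS hX hSη_nonneg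
    have hT : (0 : ℝ) ≤ M / fs := by positivity
    have h2 := SampledChannel.le_average_linearMSE_add_recoveredPower hout' hw hwT hS hX hH hSη
      hSη_nonneg hSη_zero hnoise hmatch hre hfin
    have hnn : 0 ≤ fs / M * ∫ t in (0 : ℝ)..(M / fs),
        SampledChannel.linearMSE P' (M / fs) x' y' t :=
      mul_nonneg hw.le (intervalIntegral.integral_nonneg hT fun t _ =>
        SampledChannel.linearMSE_nonneg _ t)
    -- The error of the optimal bank is bounded at every instant by the competitor's average, so
    -- averaging the left side loses nothing.
    have h3 : ∀ t, SampledChannel.linearMSE P (M / fs) x y t ≤ fs / M * ∫ t in (0 : ℝ)..(M / fs),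
        SampledChannel.linearMSE P' (M / fs) x' y' t := fun t => by
      have h1 := SampledChannel.linearMSE_add_recoveredPower_le hout hM hw hwT hS hH hSη hSη_nonneg
        hSη_zero hnoise t
      rw [← hre.lintegral_eq hw hX hout'.input.psd] at h1
      exact (ENNReal.ofReal_le_ofReal_iff hnn).1
        ((ENNReal.add_le_add_iff_right hfin.ne).1 (h1.trans h2))
    have h4 := intervalIntegral.integral_mono_on (μ := MeasureTheory.volume) hT
      ((SampledChannel.continuous_linearMSE (y := y) hout.input (M / fs)).intervalIntegrable _ _)
      intervalIntegrable_const fun t _ => h3 t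
    rw [intervalIntegral.integral_const, smul_eq_mul, sub_zero] at h4
    refine (mul_le_mul_of_nonneg_left h4 hw.le).trans (le_of_eq ?_)
    rw [← mul_assoc, hwT, one_mul]
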